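/- **Proposition (the expansion poset of the fan face is a chain).** Let $\Delta$ be a fan triangulation of an $(n+3)$-gon, i.e. a triangulation all of whose $n$ internal diagonals end at one vertex $v$. Number the vertices counterclockwise. Attach to $\Delta$ the $\mathrm{SL}_3$ cluster seed of its $3$-triangulation: there is one variable $x_{a\to b}$ for each orientation of each arc or boundary segment $ab$ (its quiver node is the one on $ab$ closer to $a$; it is frozen if $ab$ is a boundary segment), one variable $x_{abc}$ for each triangle $abc$, and for each triangle with counterclockwise vertices $a,b,c$ and each choice of a corner, called $a$, the quiver has the $3$-cycle $(a\to b)\longrightarrow(a\to c)\longrightarrow(abc)\longrightarrow(a\to b)$. A flip of a diagonal $ac$ in a quadrilateral $abcd$ (counterclockwise) is performed by mutating at the two nodes of $ac$ and then at the nodes of the two triangles $abc$, $cda$; the nodes $a\to c$, $c\to a$, $abc$, $cda$ are then attached to $abd$, $bcd$, $b\to d$, $d\to b$ respectively. Let $\gamma$ be the fan face, with vertices $v-1,v,v+1$, and let $x_\gamma$ be the variable attached to $\gamma$ in a seed reached from the initial one by flips to a triangulation containing $\gamma$. Then $x_\gamma$ is well defined: such a sequence of flips exists, and $x_\gamma$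 does not depend on it. Let $\mathbb T_\gamma$ be the set of Laurent monomials in the Laurent expansion of $x_\gamma$ in the initial variables, with the order generated by the relations $M<\hat y_kM$ whenever $M,\hat y_kM\in\mathbb T_\gamma$ and $k$ is a mutable node, where $\hat y_k=\prod_{i\to k}x_i\big/\prod_{k\to j}x_j$. Then $\mathbb T_\gamma$ is a poset isomorphic to a chain with $n+1$ elements, and its covering relations are exactly the relations $M<\hat y_kM$ above. In all of them $k$ is the node of a directed edge $v\to w$ along an internal diagonal (never the node of a triangle). -/

import Mathlib

namespace SL3Fan

noncomputable section

/-! ## Seeds and seed mutation -/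

/-- A seed with nodes `ι` in a field `K`. The quiver (without loops and 2-cycles) is recorded by
its signed arrow counts: `b i j` is the number of arrows `i → j` minus the number of arrows
`j → i`. -/
structure Seed (ι K : Type) where
  x : ι → K
  b : ι → ι → ℤ

/-- Quiver mutation at `k`: add an arrow `i → j` for each path `i → k → j`, reverse all arrows
incident to `k`, and cancel 2-cycles. -/
def mutateQuiver {ι : Type} [DecidableEq ι] (b : ι → ι → ℤ) (k : ι) : ι → ι → ℤ := fun i j =>
  if i = k ∨ j = k then - b i j
  else b i j + (max (b i k) 0 * max (b k j) 0 - max (b j k) 0 * max (b k i) 0)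

/-- Seed mutation at `k`, with exchange relation
`x_k * x_k' = ∏_{s → k} x_s + ∏_{k → t} x_t`. -/
def Seed.mutate {ι K : Type} [Fintype ι] [DecidableEq ι] [Field K] (S : Seed ι K) (k : ι) :
    Seed ι K where
  x := Function.update S.x k
    ((∏ s, S.x s ^ (S.b s k).toNat + ∏ t, S.x t ^ (S.b k t).toNat) / S.x k)
  b := mutateQuiver S.b k

/-! ## Triangulations of a polygon

The vertices of the polygon are `Fin N`, numbered counterclockwise, and `sbtw a b c` says that
`a, b, c` are distinct and occur in this counterclockwise cyclic order. -/

/-- No two arcs of `G` cross in the interior of the polygon. -/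
def Noncrossing {N : ℕ} (G : SimpleGraph (Fin N)) : Prop :=
  ∀ a b c d : Fin N, sbtw a b c → sbtw c d a → ¬ (G.Adj a c ∧ G.Adj b d)

/-- A triangulation is a maximal collection of pairwise noncrossing arcs, the boundary segments
included. -/
def IsTriangulation {N : ℕ} (G : SimpleGraph (Fin N)) : Prop :=
  Maximal Noncrossing G

/-- The segment `a b` lies on the boundary of the polygon. -/
def IsBoundary {N : ℕ} (a b : Fin N) : Prop :=
  (SimpleGraph.cycleGraph N).Adj a b

/-- Every internal diagonal has `v` as one of its endpoints. -/
def IsFanAt {N : ℕ} (G : SimpleGraph (Fin N)) (v : Fin N) : Prop :=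
  ∀ a b, G.Adj a b → ¬ IsBoundary a b → a = v ∨ b = v

/-- `a, b, c` are the vertices, in counterclockwise order, of a triangle of `G`. -/
def IsTriangle {N : ℕ} (G : SimpleGraph (Fin N)) (a b c : Fin N) : Prop :=
  sbtw a b c ∧ G.Adj a b ∧ G.Adj b c ∧ G.Adj c a

/-- The face with vertices `v - 1, v, v + 1`: the face at the fan vertex `v` which is not
contained in a proper subpolygon and is split by every internal diagonal ending at `v`. -/
def fanFace {n : ℕ} (v : Fin (n + 3)) : Finset (Fin (n + 3)) :=
  {v - 1, v, v + 1}

/-! ## The 3-triangulation quiver and its initial seed -/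

/-- Names of the `SL₃` coordinates: `edge i j` is the directed edge `i → j` (its quiver node is
the one on the segment `i j` that is closer to `i`), and `face s` is the face with set of
vertices `s`. -/
inductive Node (N : ℕ) : Type where
  | edge : Fin N → Fin N → Node N
  | face : Finset (Fin N) → Node N
  deriving DecidableEq, Fintype

/-- The nodes attached to `G`: two for each arc or boundary segment, one for each triangle. -/
inductive IsNode {N : ℕ} (G : SimpleGraph (Fin N)) : Node N → Prop where
  | edge {a b : Fin N} (h : G.Adj a b) : IsNode G (.edge a b)
  | face {a b c : Fin N} (h : IsTriangle G a b c) : IsNode G (.face {a, b, c})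

/-- The quiver nodes attached to `G`. -/
abbrev QNode {N : ℕ} (G : SimpleGraph (Fin N)) : Type := {p : Node N // IsNode G p}

instance {N : ℕ} (G : SimpleGraph (Fin N)) : Fintype (QNode G) := Fintype.ofFinite _

/-- The nodes on boundary segments are frozen, all other nodes are mutable. -/
def Node.IsFrozen {N : ℕ} : Node N → Prop
  | .edge a b => IsBoundary a b
  | .face _ => False

/-- The arrows of the 3-triangulation: for each corner `a` of each triangle `a b c` (written
counterclockwise), a clockwise 3-cycle through the two nodes closest to `a` and the face node. -/
inductive Arrow {N : ℕ} (G : SimpleGraph (Fin N)) : Node N → Node N → Prop where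
  | across {a b c : Fin N} (h : IsTriangle G a b c) : Arrow G (.edge a b) (.edge a c)
  | inward {a b c : Fin N} (h : IsTriangle G a b c) : Arrow G (.edge a c) (.face {a, b, c})
  | outward {a b c : Fin N} (h : IsTriangle G a b c) : Arrow G (.face {a, b, c}) (.edge a b)

open Classical in
/-- Signed arrow counts of the 3-triangulation quiver. -/
def initialQuiver {N : ℕ} (G : SimpleGraph (Fin N)) (p q : QNode G) : ℤ :=
  (if Arrow G p.1 q.1 then 1 else 0) - (if Arrow G q.1 p.1 then 1 else 0)

/-- The ambient field: rational functions in the initial variables. -/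
abbrev Ambient {N : ℕ} (G : SimpleGraph (Fin N)) : Type :=
  FractionRing (MvPolynomial (QNode G) ℚ)

/-- The initial variable attached to a node. -/
def initialVar {N : ℕ} (G : SimpleGraph (Fin N)) (p : QNode G) : Ambient G :=
  algebraMap (MvPolynomial (QNode G) ℚ) (Ambient G) (MvPolynomial.X p)

/-- The initial seed attached to `G`. -/
def initialSeed {N : ℕ} (G : SimpleGraph (Fin N)) : Seed (QNode G) (Ambient G) where
  x := initialVar G
  b := initialQuiver G

/-! ## Flips and the variables attached to faces -/

/-- Replace the diagonal `a c` by the diagonal `b d`. -/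
def flipGraph {N : ℕ} (T : SimpleGraph (Fin N)) (a b c d : Fin N) : SimpleGraph (Fin N) :=
  T.deleteEdges {s(a, c)} ⊔ SimpleGraph.edge b d

/-- `FlipReachable G T l S`: a sequence of flips leads from the triangulation `G`, with its initial
seed, to the triangulation `T` with the seed `S`, and `l` tells which directed edge or face of `T`
each quiver node is then attached to.

To flip the diagonal `a c` of the quadrilateral `a, b, c, d` (in counterclockwise order), mutate
at both nodes of the diagonal, and then at the nodes of the two triangles on its sides. The nodes
`a → c` and `c → a` become the nodes of the new triangles at `a` and at `c`, and the nodes of the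
old triangles at `b` and at `d` become the nodes `b → d` and `d → b`. -/
inductive FlipReachable {N : ℕ} (G : SimpleGraph (Fin N)) :
    SimpleGraph (Fin N) → (QNode G → Node N) → Seed (QNode G) (Ambient G) → Prop where
  | refl : FlipReachable G G Subtype.val (initialSeed G)
  | flip {T : SimpleGraph (Fin N)} {l : QNode G → Node N} {S : Seed (QNode G) (Ambient G)}
      (h : FlipReachable G T l S) {a b c d : Fin N}
      (habc : IsTriangle T a b c) (hcda : IsTriangle T c d a) {p q r s : QNode G}
      (hp : l p = .edge a c) (hq : l q = .edge c a)
      (hr : l r = .face {a, b, c}) (hs : l s = .face {c, d, a}) :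
      FlipReachable G (flipGraph T a b c d)
        (Function.update (Function.update (Function.update (Function.update l
          p (.face {a, b, d})) q (.face {b, c, d})) r (.edge b d)) s (.edge d b))
        ((((S.mutate p).mutate q).mutate r).mutate s)

/-- `x` is the variable attached to the face `f`: the variable at the node of `f` in a seed,
obtained from the initial seed of `G` by flips, whose triangulation has `f` as a triangle. -/
def IsFaceVariable {N : ℕ} (G : SimpleGraph (Fin N)) (f : Finset (Fin N)) (x : Ambient G) : Prop :=
  ∃ T l S, FlipReachable G T l S ∧ ∃ p, l p = Node.face f ∧ x = S.x p

/-! ## The expansion poset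

The Laurent monomial `∏ p, x_p ^ m p` in the initial variables is recorded by its exponent vector
`m : QNode G → ℤ`. -/

/-- The Laurent monomial with exponent vector `m`. -/
def laurentMonomial {N : ℕ} (G : SimpleGraph (Fin N)) (m : QNode G → ℤ) : Ambient G :=
  ∏ p, initialVar G p ^ m p

/-- `P` gives the coefficients of a Laurent expansion of `x` in the initial variables. -/
def IsLaurentExpansion {N : ℕ} (G : SimpleGraph (Fin N)) (x : Ambient G)
    (P : (QNode G → ℤ) →₀ ℤ) : Prop :=
  x = P.sum fun m c => (c : Ambient G) * laurentMonomial G m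

/-- The set of Laurent monomials occurring in the Laurent expansion of `x`. -/
def expansionMonomials {N : ℕ} (G : SimpleGraph (Fin N)) (x : Ambient G) : Set (QNode G → ℤ) :=
  {m | ∃ P, IsLaurentExpansion G x P ∧ P m ≠ 0}

/-- The exponent vector of `ŷ_k = (∏_{i → k} x_i) / (∏_{k → j} x_j)`. -/
def yhat {N : ℕ} (G : SimpleGraph (Fin N)) (k : QNode G) : QNode G → ℤ :=
  fun i => initialQuiver G i k

/-- `m'` is obtained from `m` on multiplication by `ŷ_k` for a mutable node `k`. -/
def YhatStep {N : ℕ} (G : SimpleGraph (Fin N)) (x : Ambient G)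
    (m m' : expansionMonomials G x) : Prop :=
  ∃ k : QNode G, ¬ k.1.IsFrozen ∧ m'.1 = m.1 + yhat G k

/-- The order of the expansion poset of `x`: the reflexive and transitive relation on the Laurent
monomials of `x` that is generated by multiplication by the `ŷ` variables. -/
def ExpansionLE {N : ℕ} (G : SimpleGraph (Fin N)) (x : Ambient G) :
    expansionMonomials G x → expansionMonomials G x → Prop :=
  Relation.ReflTransGen (YhatStep G x)

end

end SL3Fan

namespace SL3Fan

noncomputable section

/-! ## Flips of triangulations -/

/-! The cluster variables are read off from a configuration of flags in a three-dimensional space.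
Give each vertex `a` a vector `u_a` and a covector `φ_a` with `φ_a (u_a) = 0`, and attach `φ_a
(u_b)` to the directed edge `a → b` and `det (u_a, u_b, u_c)` to the triangle `abc`. The four
exchange relations of a flip are then four instances of the single identity `Realization.rel`. So
once the initial variables are realized by such a configuration over the ambient field, every seed
reached by flips carries the values of the same configuration (`FlipInvariant.flip`,
`FlipReachable.invariant`). In particular the variable of a face does not depend on the flips. The
divisions are legitimate because all variables stay in a set that is closed under subtraction-free
operations and omits zero.

On the quiver side, a flip affects only the twelve nodes of a quadrilateral. The arrow counts split
into those of the two triangles being replaced and those of the rest, which do not touch the four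
mutated nodes. What remains is a finite computation with a fixed quiver (`quadQuiver_flip`).

For a fan, `exists_fan_realization` builds the configuration explicitly. With `q_i` the variable of
`v → v + i` and `y_i` that of the `i`-th triangle, `det (u_v, u_{v+i}, u_{v+j}) / (q_i q_j)` is a
telescoping difference, so the fan face has variable `q_1 q_{n+2} ∑ y_l / (q_l q_{l+1})` with `1 ≤ l
≤ n + 1`. These are `n + 1` distinct Laurent monomials. Consecutive ones differ by the `ŷ` of the
edge `v → v + l + 1` (`yhat_eq`). Every other mutable `ŷ_k` contains a variable of an edge not
starting at `v`, which occurs in no term (`exists_eq_edge_of_yhat`). Comparing exponents at the face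
nodes leaves only the steps from `l` to `l + 1` (`fanExp_step_iff`). -/

theorem Noncrossing.apex_unique {N : ℕ} {G : SimpleGraph (Fin N)} (hG : Noncrossing G)
    {a b c x : Fin N} (hb : sbtw a b c) (hx : sbtw a x c) (hab : G.Adj a b) (hbc : G.Adj b c)
    (hax : G.Adj a x) (hxc : G.Adj x c) : x = b := by
  by_contra hne
  have hne' : x.val ≠ b.val := fun h => hne (Fin.ext h)
  -- Of two apexes on the same side of `a c`, if `x` comes before `b` then `a b` crosses `x c`;
  -- otherwise `a x` crosses `b c`.
  by_cases h : sbtw a x b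
  · refine hG a x b c h ?_ ⟨hab, hxc⟩
    rw [Fin.sbtw_iff] at *
    omega
  · refine hG a b x c ?_ ?_ ⟨hax, hbc⟩ <;>
    · rw [Fin.sbtw_iff] at *
      omega

/-- `(x, y, z)` is a cyclic rotation of `(a, b, c)`. -/
def IsRotation {α : Type} (a b c x y z : α) : Prop :=
  (x = a ∧ y = b ∧ z = c) ∨ (x = b ∧ y = c ∧ z = a) ∨ (x = c ∧ y = a ∧ z = b)

/-- `a, b, c, d` is a counterclockwise quadrilateral whose sides belong to `G`, but whose
diagonals do not, and `G` stays noncrossing when the diagonal `a c` is added. -/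
structure IsQuad {N : ℕ} (G : SimpleGraph (Fin N)) (a b c d : Fin N) : Prop where
  abc : sbtw a b c
  cda : sbtw c d a
  ab : G.Adj a b
  bc : G.Adj b c
  cd : G.Adj c d
  da : G.Adj d a
  nac : ¬ G.Adj a c
  nbd : ¬ G.Adj b d
  nc : Noncrossing (G ⊔ SimpleGraph.edge a c)

section Quad

variable {N : ℕ} {G : SimpleGraph (Fin N)} {a b c d : Fin N}

theorem sup_edge_adj_iff (hac : a ≠ c) {x y : Fin N} :
    (G ⊔ SimpleGraph.edge a c).Adj x y ↔ G.Adj x y ∨ (x = a ∧ y = c) ∨ (x = c ∧ y = a) := by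
  rw [SimpleGraph.sup_adj, SimpleGraph.edge_adj]
  constructor
  · rintro (h | ⟨h, -⟩)
    · exact Or.inl h
    · tauto
  · rintro (h | ⟨rfl, rfl⟩ | ⟨rfl, rfl⟩)
    · exact Or.inl h
    · exact Or.inr ⟨by tauto, hac⟩
    · exact Or.inr ⟨by tauto, hac.symm⟩

theorem IsQuad.bcd (h : IsQuad G a b c d) : sbtw b c d := by
  have h1 := h.abc
  have h2 := h.cda
  rw [Fin.sbtw_iff] at *
  omega

theorem IsQuad.dab (h : IsQuad G a b c d) : sbtw d a b := by
  have h1 := h.abc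
  have h2 := h.cda
  rw [Fin.sbtw_iff] at *
  omega

theorem ne_of_sbtw {a b c : Fin N} (h : sbtw a b c) : a ≠ b ∧ b ≠ c ∧ c ≠ a := by
  rw [Fin.sbtw_iff] at h
  refine ⟨?_, ?_, ?_⟩ <;> rintro rfl <;> omega

theorem IsQuad.ne (h : IsQuad G a b c d) :
    a ≠ b ∧ a ≠ c ∧ a ≠ d ∧ b ≠ c ∧ b ≠ d ∧ c ≠ d :=
  have h1 := ne_of_sbtw h.abc
  have h2 := ne_of_sbtw h.cda
  have h3 := ne_of_sbtw h.bcd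
  ⟨h1.1, h1.2.2.symm, h2.2.1.symm, h1.2.1, h3.2.2.symm, h2.1⟩

/-- Flipping the diagonal of a quadrilateral keeps a collection of arcs noncrossing. -/
theorem IsQuad.rotate (h : IsQuad G a b c d) : IsQuad G b c d a where
  abc := h.bcd
  cda := h.dab
  ab := h.bc
  bc := h.cd
  cd := h.da
  da := h.ab
  nac := h.nbd
  nbd := fun hh => h.nac hh.symm
  nc := by
    have hG : Noncrossing G := fun x y z w h1 h2 h3 =>
      h.nc x y z w h1 h2 ⟨Or.inl h3.1, Or.inl h3.2⟩
    obtain ⟨nab, nac, nad, nbc, nbd, ncd⟩ := h.ne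
    -- An arc of `G` that crosses `b d` is either the missing diagonal `a c` or crosses a side: `b
    -- c` or `c d` if `y ≠ c`, and `a b` or `d a` if `y = c`.
    have key : ∀ y w : Fin N, sbtw b y d → sbtw d w b → ¬ G.Adj y w := by
      intro y w hy hw hyw
      by_cases hyc : y = c
      · subst hyc
        by_cases hwa : w = a
        · subst hwa; exact h.nac hyw.symm
        · have hwa' : w.val ≠ a.val := fun h => hwa (Fin.ext h)
          by_cases hw2 : sbtw a w b
          · refine hG a w b y hw2 ?_ ⟨h.ab, hyw.symm⟩
            have := h.abc; rw [Fin.sbtw_iff] at *; omega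
          · refine hG d w a y ?_ ?_ ⟨h.da, hyw.symm⟩ <;>
            · have := h.abc; have := h.cda; rw [Fin.sbtw_iff] at *; omega
      · have hyc' : y.val ≠ c.val := fun h => hyc (Fin.ext h)
        by_cases hy2 : sbtw b y c
        · refine hG b y c w hy2 ?_ ⟨h.bc, hyw⟩
          have := h.bcd; rw [Fin.sbtw_iff] at *; omega
        · refine hG c y d w ?_ ?_ ⟨h.cd, hyw⟩ <;>
          · have := h.bcd; rw [Fin.sbtw_iff] at *; omega
    intro x y z w hxyz hzwx
    rw [sup_edge_adj_iff nbd, sup_edge_adj_iff nbd]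
    rintro ⟨h1 | ⟨rfl, rfl⟩ | ⟨rfl, rfl⟩, h2 | ⟨rfl, rfl⟩ | ⟨rfl, rfl⟩⟩
    · exact hG x y z w hxyz hzwx ⟨h1, h2⟩
    · refine key z x ?_ ?_ h1.symm <;> rw [Fin.sbtw_iff] at * <;> omega
    · refine key x z ?_ ?_ h1 <;> rw [Fin.sbtw_iff] at * <;> omega
    · exact key y w hxyz hzwx h2
    · exact (ne_of_sbtw hxyz).1 rfl
    · exact (ne_of_sbtw hxyz).2.1 rfl
    · exact key w y hzwx hxyz h2.symm
    · exact (ne_of_sbtw hxyz).2.1 rfl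
    · exact (ne_of_sbtw hxyz).1 rfl

theorem IsTriangle.rotate {x y z : Fin N} (h : IsTriangle G x y z) : IsTriangle G y z x :=
  ⟨sbtw_cyclic_left h.1, h.2.2.1, h.2.2.2, h.2.1⟩

theorem IsTriangle.mono {H : SimpleGraph (Fin N)} (hGH : G ≤ H) {x y z : Fin N}
    (h : IsTriangle G x y z) : IsTriangle H x y z :=
  ⟨h.1, hGH h.2.1, hGH h.2.2.1, hGH h.2.2.2⟩

/-- A triangle that is new must have `a c` as a side, and `apex_unique` then forces its third vertex
to be `b` or `d`. -/
theorem IsQuad.isTriangle_iff (h : IsQuad G a b c d) {x y z : Fin N} :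
    IsTriangle (G ⊔ SimpleGraph.edge a c) x y z ↔
      IsTriangle G x y z ∨ IsRotation a b c x y z ∨ IsRotation c d a x y z := by
  have hle : G ≤ G ⊔ SimpleGraph.edge a c := le_sup_left
  obtain ⟨-, nac, -⟩ := h.ne
  have eac : (G ⊔ SimpleGraph.edge a c).Adj a c := by
    rw [sup_edge_adj_iff nac]; tauto
  constructor
  · have apex1 : ∀ {w}, IsTriangle (G ⊔ SimpleGraph.edge a c) a w c → w = b := fun hw =>
      h.nc.apex_unique h.abc hw.1 (hle h.ab) (hle h.bc) hw.2.1 hw.2.2.1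
    have apex2 : ∀ {w}, IsTriangle (G ⊔ SimpleGraph.edge a c) c w a → w = d := fun hw =>
      h.nc.apex_unique h.cda hw.1 (hle h.cd) (hle h.da) hw.2.1 hw.2.2.1
    intro ht
    have ht' := ht
    obtain ⟨h1, h2, h3, h4⟩ := ht'
    rw [sup_edge_adj_iff nac] at h2 h3 h4
    rcases h2 with h2 | ⟨rfl, rfl⟩ | ⟨rfl, rfl⟩
    · rcases h3 with h3 | ⟨rfl, rfl⟩ | ⟨rfl, rfl⟩
      · rcases h4 with h4 | ⟨rfl, rfl⟩ | ⟨rfl, rfl⟩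
        · exact Or.inl ⟨h1, h2, h3, h4⟩
        · obtain rfl := apex2 ht; simp [IsRotation]
        · obtain rfl := apex1 ht; simp [IsRotation]
      · obtain rfl := apex2 ht.rotate.rotate; simp [IsRotation]
      · obtain rfl := apex1 ht.rotate.rotate; simp [IsRotation]
    · obtain rfl := apex2 ht.rotate; simp [IsRotation]
    · obtain rfl := apex1 ht.rotate; simp [IsRotation]
  · have t1 : IsTriangle (G ⊔ SimpleGraph.edge a c) a b c :=
      ⟨h.abc, hle h.ab, hle h.bc, eac.symm⟩
    have t2 : IsTriangle (G ⊔ SimpleGraph.edge a c) c d a :=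
      ⟨h.cda, hle h.cd, hle h.da, eac⟩
    rintro (ht | (⟨rfl, rfl, rfl⟩ | ⟨rfl, rfl, rfl⟩ | ⟨rfl, rfl, rfl⟩) |
      (⟨rfl, rfl, rfl⟩ | ⟨rfl, rfl, rfl⟩ | ⟨rfl, rfl, rfl⟩))
    · exact ht.mono hle
    · exact t1
    · exact t1.rotate
    · exact t1.rotate.rotate
    · exact t2
    · exact t2.rotate
    · exact t2.rotate.rotate

/-- Puts a flip into symmetric form: with the common part `G`, it passes from `G ⊔ edge a c` to `G ⊔
edge b d`, which amounts to rotating the quadrilateral by one vertex. -/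
theorem isQuad_deleteEdges {T : SimpleGraph (Fin N)} (hT : Noncrossing T)
    (habc : IsTriangle T a b c) (hcda : IsTriangle T c d a) :
    IsQuad (T.deleteEdges {s(a, c)}) a b c d ∧
      T.deleteEdges {s(a, c)} ⊔ SimpleGraph.edge a c = T := by
  obtain ⟨h1, h2, h3, h4⟩ := habc
  obtain ⟨h5, h6, h7, h8⟩ := hcda
  obtain ⟨n1, n2, n3⟩ := ne_of_sbtw h1
  obtain ⟨n4, n5, n6⟩ := ne_of_sbtw h5
  have e : T.deleteEdges {s(a, c)} ⊔ SimpleGraph.edge a c = T := by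
    ext x y
    rw [sup_edge_adj_iff n6, SimpleGraph.deleteEdges_adj]
    simp only [Set.mem_singleton_iff, Sym2.eq_iff]
    constructor
    · rintro (h | ⟨rfl, rfl⟩ | ⟨rfl, rfl⟩)
      · exact h.1
      · exact h8
      · exact h4
    · tauto
  refine ⟨⟨h1, h5, ?_, ?_, ?_, ?_, ?_, ?_, by rwa [e]⟩, e⟩
  · simp [SimpleGraph.deleteEdges_adj]; tauto
  · simp [SimpleGraph.deleteEdges_adj]; tauto
  · simp [SimpleGraph.deleteEdges_adj]; tauto
  · simp [SimpleGraph.deleteEdges_adj]; tauto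
  · simp [SimpleGraph.deleteEdges_adj]
  · intro h
    exact hT a b c d h1 h5 ⟨h8, (SimpleGraph.deleteEdges_adj.1 h).1⟩

theorem IsNode.adj_of_face {s : Finset (Fin N)} (h : IsNode G (.face s)) {x y : Fin N}
    (hx : x ∈ s) (hy : y ∈ s) (hxy : x ≠ y) : G.Adj x y := by
  cases h with
  | face h =>
    obtain ⟨-, h1, h2, h3⟩ := h
    have := h1.symm
    have := h2.symm
    have := h3.symm
    simp only [Finset.mem_insert, Finset.mem_singleton] at hx hy
    rcases hx with rfl | rfl | rfl <;> rcases hy with rfl | rfl | rfl <;>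
      first | assumption | exact absurd rfl hxy

theorem isNode_edge_iff {x y : Fin N} : IsNode G (.edge x y) ↔ G.Adj x y :=
  ⟨fun h => by cases h; assumption, .edge⟩

theorem IsNode.mono {H : SimpleGraph (Fin N)} (hGH : G ≤ H) {p : Node N} (h : IsNode G p) :
    IsNode H p := by
  cases h with
  | edge h => exact .edge (hGH h)
  | face h => exact .face (h.mono hGH)

theorem face_rotate (x y z : Fin N) : ({y, z, x} : Finset (Fin N)) = {x, y, z} := by
  ext; simp; tauto

theorem IsQuad.isNode_iff (h : IsQuad G a b c d) {p : Node N} :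
    IsNode (G ⊔ SimpleGraph.edge a c) p ↔ IsNode G p ∨ p = .edge a c ∨ p = .edge c a ∨
      p = .face {a, b, c} ∨ p = .face {c, d, a} := by
  obtain ⟨-, nac, -⟩ := h.ne
  constructor
  · rintro (hp | hp)
    · rw [sup_edge_adj_iff nac] at hp
      rcases hp with hp | ⟨rfl, rfl⟩ | ⟨rfl, rfl⟩
      · exact Or.inl (.edge hp)
      · tauto
      · tauto
    · rw [h.isTriangle_iff] at hp
      rcases hp with hp | (⟨rfl, rfl, rfl⟩ | ⟨rfl, rfl, rfl⟩ | ⟨rfl, rfl, rfl⟩) |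
        (⟨rfl, rfl, rfl⟩ | ⟨rfl, rfl, rfl⟩ | ⟨rfl, rfl, rfl⟩)
      · exact Or.inl (.face hp)
      · tauto
      · rw [face_rotate]; tauto
      · rw [face_rotate, face_rotate]; tauto
      · tauto
      · rw [face_rotate]; tauto
      · rw [face_rotate, face_rotate]; tauto
  · rintro (hp | rfl | rfl | rfl | rfl)
    · exact hp.mono le_sup_left
    · refine .edge ?_; rw [sup_edge_adj_iff nac]; tauto
    · refine .edge ?_; rw [sup_edge_adj_iff nac]; tauto
    · refine .face (h.isTriangle_iff.2 ?_); simp [IsRotation]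
    · refine .face (h.isTriangle_iff.2 ?_); simp [IsRotation]

theorem IsQuad.not_isNode (h : IsQuad G a b c d) {p : Node N}
    (hp : p = .edge a c ∨ p = .edge c a ∨ p = .face {a, b, c} ∨ p = .face {c, d, a}) :
    ¬ IsNode G p := by
  obtain ⟨-, nac, -⟩ := h.ne
  intro hn
  rcases hp with rfl | rfl | rfl | rfl
  · exact h.nac (isNode_edge_iff.1 hn)
  · exact h.nac (isNode_edge_iff.1 hn).symm
  · exact h.nac (hn.adj_of_face (by simp) (by simp) nac)
  · exact h.nac (hn.adj_of_face (by simp) (by simp) nac)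

theorem Arrow.isNode {p q : Node N} (h : Arrow G p q) : IsNode G p ∧ IsNode G q := by
  cases h with
  | across h => exact ⟨.edge h.2.1, .edge h.2.2.2.symm⟩
  | inward h => exact ⟨.edge h.2.2.2.symm, .face h⟩
  | outward h => exact ⟨.face h, .edge h.2.1⟩

end Quad

/-! ## The quiver of a quadrilateral -/

open Classical in
/-- Signed arrow counts of the 3-triangulation quiver, as a function of node names. -/
def arrowCount {N : ℕ} (G : SimpleGraph (Fin N)) (p q : Node N) : ℤ :=
  (if Arrow G p q then 1 else 0) - (if Arrow G q p then 1 else 0)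

/-- The arrows inside a quadrilateral `a b c d` with diagonal `a c`, with nodes coded by
`nodeCode`. -/
def quadArrows : List (Fin 13 × Fin 13) :=
  [(4, 0), (0, 2), (2, 4), (6, 5), (5, 2), (2, 6), (1, 7), (7, 2), (2, 1),
   (8, 1), (1, 3), (3, 8), (10, 9), (9, 3), (3, 10), (0, 11), (11, 3), (3, 0)]

/-- Signed arrow counts of the quiver of a quadrilateral. -/
def quadQuiver (u w : Fin 13) : ℤ :=
  (if (u, w) ∈ quadArrows then 1 else 0) - (if (w, u) ∈ quadArrows then 1 else 0)

/-- The name of a node in a quadrilateral `a b c d` with diagonal `a c`. -/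
def nodeName {N : ℕ} (a b c d : Fin N) (u : Fin 13) : Node N :=
  -- Codes below 4 are the nodes mutated in the flip. The last entry, a loop, is a dummy that is
  -- never a node; it keeps the naming injective.
  ![.edge a c, .edge c a, .face {a, b, c}, .face {c, d, a}, .edge a b, .edge b a, .edge b c,
    .edge c b, .edge c d, .edge d c, .edge d a, .edge a d, .edge a a] u

open Classical in
/-- Codes of the twelve nodes in a quadrilateral `a b c d` with diagonal `a c`; the code `12`
stands for all other nodes. -/
def nodeCode {N : ℕ} (a b c d : Fin N) (p : Node N) : Fin 13 :=
  if h : ∃ u, p = nodeName a b c d u then h.choose else 12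

/-- Relabelling of the vertices. -/
def Node.map {M N : ℕ} (σ : Fin M → Fin N) : Node M → Node N
  | .edge x y => .edge (σ x) (σ y)
  | .face s => .face (s.image σ)

theorem Node.map_injective {M N : ℕ} {σ : Fin M → Fin N} (hσ : Function.Injective σ) :
    Function.Injective (Node.map σ) := by
  rintro (⟨x, y⟩ | s) (⟨x', y'⟩ | s') h
  · simp only [Node.map, Node.edge.injEq] at h
    rw [hσ h.1, hσ h.2]
  · simp [Node.map] at h
  · simp [Node.map] at h
  · simp only [Node.map, Node.face.injEq] at h
    rw [Finset.image_injective hσ h]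

section Quad

variable {N : ℕ} {G : SimpleGraph (Fin N)} {a b c d : Fin N}

theorem nodeName_eq_map (a b c d : Fin N) (u : Fin 13) :
    nodeName a b c d u = Node.map ![a, b, c, d] (nodeName 0 1 2 3 u) := by
  fin_cases u <;> simp [nodeName, Node.map, Finset.image_insert]

/-- Naming commutes with injective relabelling of the vertices, so the square with vertices in `Fin
4` decides the matter. -/
theorem IsQuad.nodeName_injective (h : IsQuad G a b c d) :
    Function.Injective (nodeName a b c d) := by
  obtain ⟨n1, n2, n3, n4, n5, n6⟩ := h.ne
  have hσ : Function.Injective ![a, b, c, d] := by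
    intro i j hij
    fin_cases i <;> fin_cases j <;> first | rfl | (simp at hij; tauto)
  have h4 : Function.Injective (nodeName (0 : Fin 4) 1 2 3) := by decide
  intro u w huw
  rw [nodeName_eq_map, nodeName_eq_map a b c d w] at huw
  exact h4 (Node.map_injective hσ huw)

theorem IsQuad.nodeCode_eq (h : IsQuad G a b c d) (p : Node N) {u : Fin 13} (hu : u ≠ 12) :
    nodeCode a b c d p = u ↔ p = nodeName a b c d u := by
  unfold nodeCode
  split_ifs with hp
  · conv_rhs => rw [hp.choose_spec]
    exact h.nodeName_injective.eq_iff.symm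
  · exact ⟨fun e => absurd e.symm hu, fun e => absurd ⟨u, e⟩ hp⟩

theorem IsQuad.nodeCode_nodeName (h : IsQuad G a b c d) {u : Fin 13} (hu : u ≠ 12) :
    nodeCode a b c d (nodeName a b c d u) = u :=
  (h.nodeCode_eq _ hu).2 rfl

theorem IsQuad.mem_quadArrows_iff (h : IsQuad G a b c d) (p q : Node N) :
    (nodeCode a b c d p, nodeCode a b c d q) ∈ quadArrows ↔
      ∃ w ∈ quadArrows, p = nodeName a b c d w.1 ∧ q = nodeName a b c d w.2 := by
  have hq : ∀ w ∈ quadArrows, w.1 ≠ 12 ∧ w.2 ≠ 12 := by simp [quadArrows]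
  constructor
  · intro hw
    exact ⟨_, hw, (h.nodeCode_eq _ (hq _ hw).1).1 rfl, (h.nodeCode_eq _ (hq _ hw).2).1 rfl⟩
  · rintro ⟨w, hw, rfl, rfl⟩
    rwa [h.nodeCode_nodeName (hq _ hw).1, h.nodeCode_nodeName (hq _ hw).2]

/-- The arrows in the triangle `a b c`. -/
def TriangleArrow (a b c : Fin N) (p q : Node N) : Prop :=
  (p = .edge a b ∧ q = .edge a c) ∨ (p = .edge a c ∧ q = .face {a, b, c}) ∨
    (p = .face {a, b, c} ∧ q = .edge a b)

theorem arrow_iff {p q : Node N} :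
    Arrow G p q ↔ ∃ x y z, IsTriangle G x y z ∧ TriangleArrow x y z p q := by
  constructor
  · rintro (h | h | h) <;> exact ⟨_, _, _, h, by simp [TriangleArrow]⟩
  · rintro ⟨x, y, z, h, ⟨rfl, rfl⟩ | ⟨rfl, rfl⟩ | ⟨rfl, rfl⟩⟩
    · exact .across h
    · exact .inward h
    · exact .outward h

theorem IsQuad.arrow_iff (h : IsQuad G a b c d) (p q : Node N) :
    Arrow (G ⊔ SimpleGraph.edge a c) p q ↔
      Arrow G p q ∨ (nodeCode a b c d p, nodeCode a b c d q) ∈ quadArrows := by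
  rw [h.mem_quadArrows_iff, SL3Fan.arrow_iff, SL3Fan.arrow_iff]
  simp only [h.isTriangle_iff, or_and_right, exists_or]
  refine or_congr Iff.rfl ?_
  simp only [IsRotation, TriangleArrow, quadArrows, List.mem_cons, List.not_mem_nil, or_false,
    or_and_right, exists_or, and_assoc, exists_and_left, exists_eq_left]
  simp only [nodeName, Matrix.cons_val, face_rotate a b c, face_rotate b c a, face_rotate c d a,
    face_rotate d a c, or_assoc]

end Quad

section Quad

variable {N : ℕ} {G : SimpleGraph (Fin N)} {a b c d : Fin N}

theorem IsQuad.not_isNode_nodeName (h : IsQuad G a b c d) {u : Fin 13} (hu : u < 4) :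
    ¬ IsNode G (nodeName a b c d u) := by
  refine h.not_isNode ?_
  match u, hu with
  | 0, _ => simp [nodeName]
  | 1, _ => simp [nodeName]
  | 2, _ => simp [nodeName]
  | 3, _ => simp [nodeName]

/-- Disjointness is what makes the arrow indicators additive. An arrow of the quadrilateral either
meets one of the four nodes absent from `G`, or joins two sides at the corner `b` or `d`, and then
it would need a triangle of `G` with side `a c`. -/
theorem IsQuad.not_arrow (h : IsQuad G a b c d) {p q : Node N} (hpq : Arrow G p q) :
    (nodeCode a b c d p, nodeCode a b c d q) ∉ quadArrows := by
  rw [h.mem_quadArrows_iff]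
  rintro ⟨w, hw, rfl, rfl⟩
  obtain ⟨hp, hq⟩ := hpq.isNode
  have h4 : ∀ w ∈ quadArrows, w.1 < 4 ∨ w.2 < 4 ∨ w = (6, 5) ∨ w = (10, 9) := by
    simp [quadArrows]
  rcases h4 w hw with h1 | h1 | rfl | rfl
  · exact h.not_isNode_nodeName h1 hp
  · exact h.not_isNode_nodeName h1 hq
  · change Arrow G (.edge b c) (.edge b a) at hpq
    cases hpq with
    | across ht => exact h.nac ht.2.2.1.symm
  · change Arrow G (.edge d a) (.edge d c) at hpq
    cases hpq with
    | across ht => exact h.nac ht.2.2.1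

open Classical in
theorem IsQuad.arrowCount_eq (h : IsQuad G a b c d) (p q : Node N) :
    arrowCount (G ⊔ SimpleGraph.edge a c) p q =
      arrowCount G p q + quadQuiver (nodeCode a b c d p) (nodeCode a b c d q) := by
  have h1 := h.not_arrow (p := p) (q := q)
  have h2 := h.not_arrow (p := q) (q := p)
  have key : ∀ {P Q R : Prop} [Decidable P] [Decidable Q] [Decidable R],
      (P ↔ Q ∨ R) → (Q → ¬ R) →
      (if P then 1 else 0 : ℤ) = (if Q then 1 else 0) + (if R then 1 else 0) := by
    intro P Q R _ _ _ h1 h2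
    by_cases hQ : Q <;> by_cases hR : R <;> simp_all
  simp only [arrowCount, quadQuiver]
  rw [key (h.arrow_iff p q) h1, key (h.arrow_iff q p) h2]
  ring

theorem arrowCount_eq_zero_left {p : Node N} (hp : ¬ IsNode G p) (q : Node N) :
    arrowCount G p q = 0 := by
  have h1 : ¬ Arrow G p q := fun h => hp h.isNode.1
  have h2 : ¬ Arrow G q p := fun h => hp h.isNode.2
  simp [arrowCount, h1, h2]

theorem arrowCount_eq_zero_right {p : Node N} (hp : ¬ IsNode G p) (q : Node N) :
    arrowCount G q p = 0 := by
  have h1 : ¬ Arrow G p q := fun h => hp h.isNode.1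
  have h2 : ¬ Arrow G q p := fun h => hp h.isNode.2
  simp [arrowCount, h1, h2]

end Quad

/-- No arrow of `R` meets `k`, so all paths through `k` come from `M`. Pulling back along `c`
creates no extra copies of `k`, since `k` is alone in its fibre. -/
theorem mutateQuiver_add_comp {ι κ : Type} [DecidableEq ι] [DecidableEq κ] {R : ι → ι → ℤ}
    {M : κ → κ → ℤ} {c : ι → κ} {k : ι} (h1 : ∀ i, R k i = 0) (h2 : ∀ i, R i k = 0)
    (hc : ∀ i, c i = c k → i = k) :
    mutateQuiver (fun i j => R i j + M (c i) (c j)) k =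
      fun i j => R i j + mutateQuiver M (c k) (c i) (c j) := by
  funext i j
  have hi : c i = c k ↔ i = k := ⟨hc i, fun h => by rw [h]⟩
  have hj : c j = c k ↔ j = k := ⟨hc j, fun h => by rw [h]⟩
  simp only [mutateQuiver, hi, hj, h1, h2, zero_add]
  split_ifs with h
  · rcases h with rfl | rfl
    · rw [h1]; ring
    · rw [h2]; ring
  · ring

theorem prod_pow_indicator {ι M : Type} [Fintype ι] [DecidableEq ι] [CommMonoid M]
    (x : ι → M) (e : ι → ℕ) {i j : ι} (hij : i ≠ j)
    (he : ∀ s, e s = if s = i ∨ s = j then 1 else 0) : ∏ s, x s ^ e s = x i * x j := by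
  rw [← Finset.prod_pair hij, ← Finset.prod_subset (Finset.subset_univ {i, j})]
  · refine Finset.prod_congr rfl fun s hs => ?_
    rw [he, if_pos (by simpa using hs), pow_one]
  · intro s _ hs
    rw [he, if_neg (by simpa using hs), pow_zero]

/-- The quiver of a quadrilateral after the first mutations of a flip. -/
def quadQuiver₁ : Fin 13 → Fin 13 → ℤ := mutateQuiver quadQuiver 0
def quadQuiver₂ : Fin 13 → Fin 13 → ℤ := mutateQuiver quadQuiver₁ 1
def quadQuiver₃ : Fin 13 → Fin 13 → ℤ := mutateQuiver quadQuiver₂ 2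

/-- The effect of a flip on the codes of the nodes. -/
def flipCode (u : Fin 13) : Fin 13 := ![3, 2, 0, 1, 10, 11, 4, 5, 6, 7, 8, 9, 12] u

set_option maxRecDepth 100000 in
-- The whole quiver part of a flip: four mutations turn the local quiver into that of the other
-- diagonal, including the arrows between adjacent sides.
theorem quadQuiver_flip : ∀ u w : Fin 13,
    mutateQuiver quadQuiver₃ 3 u w = quadQuiver (flipCode u) (flipCode w) := by
  decide

/-- `w₁, w₂` are the sources of the arrows into `u`, and `w₃, w₄` the targets of the arrows
out of `u`. -/
def HasNeighbours (M : Fin 13 → Fin 13 → ℤ) (u w₁ w₂ w₃ w₄ : Fin 13) : Prop :=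
  (∀ w, (M w u).toNat = if w = w₁ ∨ w = w₂ then 1 else 0) ∧
    ∀ w, (M u w).toNat = if w = w₃ ∨ w = w₄ then 1 else 0

instance (M : Fin 13 → Fin 13 → ℤ) (u w₁ w₂ w₃ w₄ : Fin 13) :
    Decidable (HasNeighbours M u w₁ w₂ w₃ w₄) :=
  inferInstanceAs (Decidable (_ ∧ _))

set_option maxRecDepth 100000 in
-- In each of the four mutations the node has two sources and two targets, so the exchange relation
-- has the shape of `Realization.rel`.
theorem hasNeighbours₀ : HasNeighbours quadQuiver 0 4 3 2 11 := by decide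

set_option maxRecDepth 100000 in
theorem hasNeighbours₁ : HasNeighbours quadQuiver₁ 1 8 2 3 7 := by decide

set_option maxRecDepth 100000 in
theorem hasNeighbours₂ : HasNeighbours quadQuiver₂ 2 1 5 6 0 := by decide

set_option maxRecDepth 100000 in
theorem hasNeighbours₃ : HasNeighbours quadQuiver₃ 3 0 9 10 1 := by decide

/-! ## Realizations of the coordinates -/

/-- Functions behaving like `e a b = φ_a (u_b)` and `t a b c = det (u_a, u_b, u_c)` for vectors
`u_a` and covectors `φ_a` with `φ_a (u_a) = 0` in a three-dimensional space. -/
structure Realization (N : ℕ) (K : Type) [Field K] where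
  e : Fin N → Fin N → K
  t : Fin N → Fin N → Fin N → K
  cyc : ∀ a b c, t b c a = t a b c
  -- This is `φ_a` applied to the Cramer relation between `u_a, u_b, u_c, u_d`; the term in `u_a`
  -- drops out because `φ_a (u_a) = 0`.
  rel : ∀ a b c d, e a c * t a b d = e a b * t a c d + e a d * t a b c

theorem isRotation_of_face_eq {N : ℕ} {a b c x y z : Fin N} (h : sbtw a b c) (h' : sbtw x y z)
    (e : ({x, y, z} : Finset (Fin N)) = {a, b, c}) : IsRotation a b c x y z := by
  have hx : x ∈ ({a, b, c} : Finset (Fin N)) := by rw [← e]; simp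
  have hy : y ∈ ({a, b, c} : Finset (Fin N)) := by rw [← e]; simp
  have hz : z ∈ ({a, b, c} : Finset (Fin N)) := by rw [← e]; simp
  simp only [Finset.mem_insert, Finset.mem_singleton] at hx hy hz
  obtain ⟨n1, n2, n3⟩ := ne_of_sbtw h'
  rw [Fin.sbtw_iff] at h h'
  rcases hx with rfl | rfl | rfl <;> rcases hy with rfl | rfl | rfl <;>
    rcases hz with rfl | rfl | rfl <;>
    first
    | exact absurd rfl n1
    | exact absurd rfl n2
    | exact absurd rfl n3
    | exact Or.inl ⟨rfl, rfl, rfl⟩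
    | exact Or.inr (Or.inl ⟨rfl, rfl, rfl⟩)
    | exact Or.inr (Or.inr ⟨rfl, rfl, rfl⟩)
    | (exfalso; omega)

open Classical in
/-- The value attached to a node by a realization. -/
def Realization.val {N : ℕ} {K : Type} [Field K] (ρ : Realization N K) : Node N → K
  | .edge a b => ρ.e a b
  | .face s =>
    if h : ∃ w : Fin N × Fin N × Fin N, sbtw w.1 w.2.1 w.2.2 ∧ {w.1, w.2.1, w.2.2} = s then
      ρ.t h.choose.1 h.choose.2.1 h.choose.2.2 else 0

/-- Two counterclockwise orderings of the same vertex set differ by a rotation, under which `t` is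
invariant, so the choice made in `val` is harmless. -/
theorem Realization.val_face {N : ℕ} {K : Type} [Field K] (ρ : Realization N K) {a b c : Fin N}
    (h : sbtw a b c) : ρ.val (.face {a, b, c}) = ρ.t a b c := by
  have hex : ∃ w : Fin N × Fin N × Fin N,
      sbtw w.1 w.2.1 w.2.2 ∧ ({w.1, w.2.1, w.2.2} : Finset (Fin N)) = {a, b, c} :=
    ⟨(a, b, c), h, rfl⟩
  simp only [Realization.val]
  rw [dif_pos hex]
  obtain ⟨h1, h2⟩ := hex.choose_spec
  rcases isRotation_of_face_eq h h1 h2 with ⟨e1, e2, e3⟩ | ⟨e1, e2, e3⟩ | ⟨e1, e2, e3⟩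
  · rw [e1, e2, e3]
  · rw [e1, e2, e3, ρ.cyc]
  · rw [e1, e2, e3, ρ.cyc, ρ.cyc]

/-- A set of nonzero elements closed under subtraction-free operations. -/
structure IsPositiveCone {K : Type} [Field K] (P : Set K) : Prop where
  add : ∀ {x y}, x ∈ P → y ∈ P → x + y ∈ P
  mul : ∀ {x y}, x ∈ P → y ∈ P → x * y ∈ P
  div : ∀ {x y}, x ∈ P → y ∈ P → x / y ∈ P
  zero : (0 : K) ∉ P

/-- The properties of the labelled seeds reached by flips. -/
structure FlipInvariant {N : ℕ} {ι K : Type} [Field K] (P : Set K) (ρ : Realization N K)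
    (T : SimpleGraph (Fin N)) (l : ι → Node N) (S : Seed ι K) : Prop where
  nc : Noncrossing T
  inj : Function.Injective l
  node : ∀ p, IsNode T p ↔ ∃ i, l i = p
  b : S.b = fun i j => arrowCount T (l i) (l j)
  x : S.x = ρ.val ∘ l
  pos : ∀ i, S.x i ∈ P

/-! ### Flips preserve the invariant -/

section Flip

variable {N : ℕ} {G : SimpleGraph (Fin N)} {a b c d : Fin N}

theorem nodeName_flipCode {u : Fin 13} (hu : ¬ u < 4) (hu' : u ≠ 12) :
    nodeName b c d a (flipCode u) = nodeName a b c d u := by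
  fin_cases u <;> first | rfl | exact absurd (by decide) hu | exact absurd rfl hu'

theorem flipCode_facts : (∀ u, u < 4 → flipCode u < 4) ∧ Function.Injective flipCode ∧
    ∀ w, w ≠ 12 → ∃ u, flipCode u = w ∧ u ≠ 12 ∧ (u < 4 ↔ w < 4) := by
  refine ⟨by decide, by decide, by decide⟩

theorem IsQuad.isNode_iff_nodeName (h : IsQuad G a b c d) {p : Node N} :
    IsNode (G ⊔ SimpleGraph.edge a c) p ↔ IsNode G p ∨ ∃ u < 4, p = nodeName a b c d u := by
  rw [h.isNode_iff]
  refine or_congr Iff.rfl ⟨?_, ?_⟩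
  · rintro (rfl | rfl | rfl | rfl)
    · exact ⟨0, by decide, rfl⟩
    · exact ⟨1, by decide, rfl⟩
    · exact ⟨2, by decide, rfl⟩
    · exact ⟨3, by decide, rfl⟩
  · rintro ⟨u, hu, rfl⟩
    match u, hu with
    | 0, _ => simp [nodeName]
    | 1, _ => simp [nodeName]
    | 2, _ => simp [nodeName]
    | 3, _ => simp [nodeName]

/-- A node of `G` is none of the four mutated ones, before or after the flip, so it is a side of the
quadrilateral, whose code merely shifts, or lies outside it. -/
theorem IsQuad.nodeCode_rotate (h : IsQuad G a b c d) {p : Node N} (hp : IsNode G p) :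
    nodeCode b c d a p = flipCode (nodeCode a b c d p) := by
  by_cases hu : nodeCode a b c d p = 12
  · rw [hu]
    by_contra hw
    change nodeCode b c d a p ≠ 12 at hw
    have hw' := (h.rotate.nodeCode_eq p hw).1 rfl
    obtain ⟨u, h1, h2, h3⟩ := flipCode_facts.2.2 _ hw
    by_cases h4 : nodeCode b c d a p < 4
    · exact h.rotate.not_isNode_nodeName h4 (hw' ▸ hp)
    · rw [← h1, nodeName_flipCode (by tauto) h2] at hw'
      rw [(h.nodeCode_eq p h2).2 hw'] at hu
      exact h2 hu
  · have hp' := (h.nodeCode_eq p hu).1 rfl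
    have h4 : ¬ nodeCode a b c d p < 4 := fun h4 => h.not_isNode_nodeName h4 (hp' ▸ hp)
    rw [h.rotate.nodeCode_eq _ (by revert hu; generalize nodeCode a b c d p = u; revert u; decide),
      nodeName_flipCode h4 hu]
    exact hp'

theorem IsQuad.isNode_nodeName (h : IsQuad G a b c d) {u : Fin 13} (hu : u ≠ 12) :
    IsNode (G ⊔ SimpleGraph.edge a c) (nodeName a b c d u) := by
  by_cases h4 : u < 4
  · exact h.isNode_iff_nodeName.2 (Or.inr ⟨u, h4, rfl⟩)
  · refine IsNode.mono (le_sup_left (a := G)) ?_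
    have h1 := h.ab
    have h2 := h.bc
    have h3 := h.cd
    have h5 := h.da
    have h1' := h.ab.symm
    have h2' := h.bc.symm
    have h3' := h.cd.symm
    have h5' := h.da.symm
    fin_cases u <;>
      first
      | exact absurd (by decide) h4
      | exact absurd rfl hu
      | exact .edge (by assumption)

theorem mutate_x_of_hasNeighbours {ι K : Type} [Fintype ι] [DecidableEq ι] [Field K]
    {S : Seed ι K} {R : ι → ι → ℤ} {M : Fin 13 → Fin 13 → ℤ} {c : ι → Fin 13}
    {k i₁ i₂ i₃ i₄ : ι} {w₁ w₂ w₃ w₄ : Fin 13}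
    (hb : S.b = fun i j => R i j + M (c i) (c j)) (h1 : ∀ i, R k i = 0) (h2 : ∀ i, R i k = 0)
    (hM : HasNeighbours M (c k) w₁ w₂ w₃ w₄) (e₁ : ∀ i, c i = w₁ ↔ i = i₁)
    (e₂ : ∀ i, c i = w₂ ↔ i = i₂) (e₃ : ∀ i, c i = w₃ ↔ i = i₃) (e₄ : ∀ i, c i = w₄ ↔ i = i₄)
    (n₁ : i₁ ≠ i₂) (n₂ : i₃ ≠ i₄) :
    (S.mutate k).x =
      Function.update S.x k ((S.x i₁ * S.x i₂ + S.x i₃ * S.x i₄) / S.x k) := by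
  simp only [Seed.mutate]
  rw [prod_pow_indicator S.x (fun s => (S.b s k).toNat) n₁,
    prod_pow_indicator S.x (fun s => (S.b k s).toNat) n₂]
  · intro s
    simp only [hb, h1, zero_add, hM.2, e₃, e₄]
  · intro s
    simp only [hb, h2, zero_add, hM.1, e₁, e₂]

end Flip

section Flip

variable {N : ℕ} {G : SimpleGraph (Fin N)} {a b c d : Fin N}

/-- The nodes after a flip: either mutated ones, or old ones away from the flip. -/
theorem FlipInvariant.relabel {ι K : Type} [Field K] [DecidableEq ι] {P : Set K}
    {ρ : Realization N K} {l : ι → Node N} {S : Seed ι K} (hq : IsQuad G a b c d)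
    (hI : FlipInvariant P ρ (G ⊔ SimpleGraph.edge a c) l S) {p q r s : ι}
    (hp : l p = .edge a c) (hq' : l q = .edge c a)
    (hr : l r = .face {a, b, c}) (hs : l s = .face {c, d, a}) {l' : ι → Node N}
    (hl' : l' = (Function.update (Function.update (Function.update (Function.update l
      p (.face {a, b, d})) q (.face {b, c, d})) r (.edge b d)) s (.edge d b))) (i : ι) :
    (nodeCode a b c d (l i) < 4 ∧ l i = nodeName a b c d (nodeCode a b c d (l i)) ∧
      l' i = nodeName b c d a (flipCode (nodeCode a b c d (l i)))) ∨
    (¬ nodeCode a b c d (l i) < 4 ∧ l' i = l i ∧ IsNode G (l i)) := by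
  have npq : p ≠ q := by
    rintro rfl; rw [hp] at hq'; simp at hq'; exact (hq.ne).2.1 hq'.1
  have npr : p ≠ r := by rintro rfl; rw [hp] at hr; simp at hr
  have nps : p ≠ s := by rintro rfl; rw [hp] at hs; simp at hs
  have nqr : q ≠ r := by rintro rfl; rw [hq'] at hr; simp at hr
  have nqs : q ≠ s := by rintro rfl; rw [hq'] at hs; simp at hs
  have nrs : r ≠ s := by
    rintro rfl
    exact absurd (hq.nodeName_injective (a₁ := 2) (a₂ := 3) (hr.symm.trans hs)) (by decide)
  have cp : nodeCode a b c d (l p) = 0 := (hq.nodeCode_eq _ (by decide)).2 hp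
  have cq : nodeCode a b c d (l q) = 1 := (hq.nodeCode_eq _ (by decide)).2 hq'
  have cr : nodeCode a b c d (l r) = 2 := (hq.nodeCode_eq _ (by decide)).2 hr
  have cs : nodeCode a b c d (l s) = 3 := (hq.nodeCode_eq _ (by decide)).2 hs
  by_cases h4 : nodeCode a b c d (l i) < 4
  · left
    have hne : nodeCode a b c d (l i) ≠ 12 := by
      intro e; rw [e] at h4; exact absurd h4 (by decide)
    have hname := (hq.nodeCode_eq (l i) hne).1 rfl
    refine ⟨h4, hname, ?_⟩
    have hi : ∀ u, nodeCode a b c d (l i) = u → u ≠ 12 → l i = nodeName a b c d u :=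
      fun u e hu => (hq.nodeCode_eq _ hu).1 e
    have h4' : ∀ u : Fin 13, u < 4 → u = 0 ∨ u = 1 ∨ u = 2 ∨ u = 3 := by decide
    rcases h4' _ h4 with e | e | e | e
    · obtain rfl := hI.inj ((hi _ e (by decide)).trans hp.symm)
      rw [hl', e]
      simp [npq, npr, nps, nodeName, flipCode, ← face_rotate a b d, ← face_rotate b d a]
    · obtain rfl := hI.inj ((hi _ e (by decide)).trans hq'.symm)
      rw [hl', e]
      simp [nqr, nqs, nodeName, flipCode]
    · obtain rfl := hI.inj ((hi _ e (by decide)).trans hr.symm)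
      rw [hl', e]
      simp [nrs, nodeName, flipCode]
    · obtain rfl := hI.inj ((hi _ e (by decide)).trans hs.symm)
      rw [hl', e]
      simp [nodeName, flipCode]
  · right
    have np : i ≠ p := by rintro rfl; rw [cp] at h4; exact h4 (by decide)
    have nq : i ≠ q := by rintro rfl; rw [cq] at h4; exact h4 (by decide)
    have nr : i ≠ r := by rintro rfl; rw [cr] at h4; exact h4 (by decide)
    have ns : i ≠ s := by rintro rfl; rw [cs] at h4; exact h4 (by decide)
    refine ⟨h4, by rw [hl']; simp [np, nq, nr, ns], ?_⟩
    rcases hq.isNode_iff_nodeName.1 ((hI.node _).2 ⟨i, rfl⟩) with h | ⟨u, hu, h⟩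
    · exact h
    · have hu' : u ≠ 12 := by rintro rfl; exact absurd hu (by decide)
      rw [(hq.nodeCode_eq _ hu').2 h] at h4
      exact absurd hu h4

/-- The exchange relations at the four nodes are `rel` based at `a`, `c`, `b`, `d` in this order;
the last two use the values `t a b d` and `t b c d` produced by the first two. -/
theorem FlipInvariant.flip {ι K : Type} [Field K] [Fintype ι] [DecidableEq ι] {P : Set K}
    (hP : IsPositiveCone P) {ρ : Realization N K} {l : ι → Node N} {S : Seed ι K}
    (hq : IsQuad G a b c d) (hI : FlipInvariant P ρ (G ⊔ SimpleGraph.edge a c) l S) {p q r s : ι}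
    (hp : l p = .edge a c) (hq' : l q = .edge c a)
    (hr : l r = .face {a, b, c}) (hs : l s = .face {c, d, a}) :
    FlipInvariant P ρ (G ⊔ SimpleGraph.edge b d)
      (Function.update (Function.update (Function.update (Function.update l
        p (.face {a, b, d})) q (.face {b, c, d})) r (.edge b d)) s (.edge d b))
      ((((S.mutate p).mutate q).mutate r).mutate s) := by
  obtain ⟨l', hl'⟩ : ∃ l' : ι → Node N, l' =
    (Function.update (Function.update (Function.update (Function.update l
      p (.face {a, b, d})) q (.face {b, c, d})) r (.edge b d)) s (.edge d b)) := ⟨_, rfl⟩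
  have key := hI.relabel hq hp hq' hr hs hl'
  have hflip4 : ∀ u, u < 4 → flipCode u < 4 := flipCode_facts.1
  have hlt : ∀ {u : Fin 13}, u < 4 → u ≠ 12 := by
    rintro u hu rfl; exact absurd hu (by decide)
  have code' : ∀ i, nodeCode b c d a (l' i) = flipCode (nodeCode a b c d (l i)) := by
    intro i
    rcases key i with ⟨h1, h2, h3⟩ | ⟨h1, h2, h3⟩
    · rw [h3, hq.rotate.nodeCode_nodeName (hlt (hflip4 _ h1))]
    · rw [h2, hq.nodeCode_rotate h3]
  have hidx : ∀ u : Fin 13, ∃ i, u ≠ 12 → l i = nodeName a b c d u := by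
    intro u
    by_cases hu : u = 12
    · exact ⟨p, fun h => absurd hu h⟩
    · obtain ⟨i, hi⟩ := (hI.node _).1 (hq.isNode_nodeName hu)
      exact ⟨i, fun _ => hi⟩
  choose idx hidx using hidx
  have hc : ∀ u : Fin 13, u ≠ 12 → ∀ i, nodeCode a b c d (l i) = u ↔ i = idx u := by
    intro u hu i
    rw [hq.nodeCode_eq _ hu, ← hidx u hu]
    exact hI.inj.eq_iff
  have hcc : ∀ u : Fin 13, u ≠ 12 → nodeCode a b c d (l (idx u)) = u :=
    fun u hu => (hc u hu _).2 rfl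
  have hne : ∀ u w : Fin 13, u ≠ 12 → w ≠ 12 → u ≠ w → idx u ≠ idx w := by
    intro u w hu hw h e
    exact h (by rw [← hcc u hu, e, hcc w hw])
  obtain rfl : p = idx 0 := hI.inj (hp.trans (hidx 0 (by decide)).symm)
  obtain rfl : q = idx 1 := hI.inj (hq'.trans (hidx 1 (by decide)).symm)
  obtain rfl : r = idx 2 := hI.inj (hr.trans (hidx 2 (by decide)).symm)
  obtain rfl : s = idx 3 := hI.inj (hs.trans (hidx 3 (by decide)).symm)
  have z1 : ∀ u < 4, ∀ i, arrowCount G (l (idx u)) (l i) = 0 := fun u hu i =>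
    arrowCount_eq_zero_left (by rw [hidx u (hlt hu)]; exact hq.not_isNode_nodeName hu) _
  have z2 : ∀ u < 4, ∀ i, arrowCount G (l i) (l (idx u)) = 0 := fun u hu i =>
    arrowCount_eq_zero_right (by rw [hidx u (hlt hu)]; exact hq.not_isNode_nodeName hu) _
  -- Throughout the flip the quiver remains the fixed part from `G` plus the pullback of a quiver on
  -- the thirteen codes, and only the latter is mutated.
  have step : ∀ (S : Seed ι K) (M : Fin 13 → Fin 13 → ℤ) (u : Fin 13), u < 4 →
      S.b = (fun i j => arrowCount G (l i) (l j) +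
        M (nodeCode a b c d (l i)) (nodeCode a b c d (l j))) →
      (S.mutate (idx u)).b = (fun i j => arrowCount G (l i) (l j) +
        mutateQuiver M u (nodeCode a b c d (l i)) (nodeCode a b c d (l j))) := by
    intro S M u hu hb
    have := mutateQuiver_add_comp (R := fun i j => arrowCount G (l i) (l j)) (M := M)
      (c := fun i => nodeCode a b c d (l i)) (k := idx u) (z1 u hu) (z2 u hu)
      (fun i hi => (hc u (hlt hu) i).1 (hi.trans (hcc u (hlt hu))))
    rw [hcc u (hlt hu)] at this
    rw [← this, ← hb]
    rfl
  have b0 : S.b = fun i j => arrowCount G (l i) (l j) +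
      quadQuiver (nodeCode a b c d (l i)) (nodeCode a b c d (l j)) := by
    rw [hI.b]; funext i j; exact hq.arrowCount_eq _ _
  have b1 := step _ _ 0 (by decide) b0
  have b2 := step _ _ 1 (by decide) b1
  have b3 := step _ _ 2 (by decide) b2
  have b4 := step _ _ 3 (by decide) b3
  have val : ∀ u, u ≠ 12 → S.x (idx u) = ρ.val (nodeName a b c d u) := by
    intro u hu; rw [hI.x, Function.comp_apply, hidx u hu]
  have xstep : ∀ (S : Seed ι K) (M : Fin 13 → Fin 13 → ℤ) (u w₁ w₂ w₃ w₄ : Fin 13), u < 4 →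
      HasNeighbours M u w₁ w₂ w₃ w₄ →
      S.b = (fun i j => arrowCount G (l i) (l j) +
        M (nodeCode a b c d (l i)) (nodeCode a b c d (l j))) →
      w₁ ≠ 12 → w₂ ≠ 12 → w₃ ≠ 12 → w₄ ≠ 12 → w₁ ≠ w₂ → w₃ ≠ w₄ →
      (∀ i, S.x i ∈ P) →
      ∀ y, S.x (idx w₁) * S.x (idx w₂) + S.x (idx w₃) * S.x (idx w₄) = S.x (idx u) * y →
        (S.mutate (idx u)).x = Function.update S.x (idx u) y ∧
          ∀ i, (S.mutate (idx u)).x i ∈ P := by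
    intro S M u w₁ w₂ w₃ w₄ hu hM hb n1 n2 n3 n4 n12 n34 hpos y hy
    have hx := mutate_x_of_hasNeighbours hb (z1 u hu) (z2 u hu)
      (by rw [hcc u (hlt hu)]; exact hM) (hc _ n1) (hc _ n2) (hc _ n3) (hc _ n4)
      (hne _ _ n1 n2 n12) (hne _ _ n3 n4 n34)
    have h0 : S.x (idx u) ≠ 0 := fun h => hP.zero (h ▸ hpos (idx u))
    constructor
    · rw [hx, hy, mul_div_cancel_left₀ _ h0]
    · intro i
      rw [hx]
      by_cases hi : i = idx u
      · subst hi
        rw [Function.update_self]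
        exact hP.div (hP.add (hP.mul (hpos _) (hpos _)) (hP.mul (hpos _) (hpos _))) (hpos _)
      · rw [Function.update_of_ne hi]
        exact hpos i
  have v0 := val 0 (by decide)
  have v1 := val 1 (by decide)
  have v2 := val 2 (by decide)
  have v3 := val 3 (by decide)
  have v4 := val 4 (by decide)
  have v5 := val 5 (by decide)
  have v6 := val 6 (by decide)
  have v7 := val 7 (by decide)
  have v8 := val 8 (by decide)
  have v9 := val 9 (by decide)
  have v10 := val 10 (by decide)
  have v11 := val 11 (by decide)
  simp only [nodeName, Matrix.cons_val, Realization.val_face ρ hq.abc,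
    Realization.val_face ρ hq.cda] at v0 v1 v2 v3
  simp only [nodeName, Matrix.cons_val] at v4 v5 v6 v7 v8 v9 v10 v11
  simp only [Realization.val] at v0 v1 v4 v5 v6 v7 v8 v9 v10 v11
  obtain ⟨x1, p1⟩ := xstep _ _ 0 4 3 2 11 (by decide) hasNeighbours₀ b0 (by decide) (by decide)
    (by decide) (by decide) (by decide) (by decide) hI.pos (ρ.t a b d) (by
      rw [v0, v2, v3, v4, v11, ρ.rel a b c d, ρ.cyc a c d]; ring)
  have u1 : ∀ u, u ≠ 12 → u ≠ 0 → (S.mutate (idx 0)).x (idx u) = S.x (idx u) := by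
    intro u hu h0
    rw [x1, Function.update_of_ne (hne u 0 hu (by decide) h0)]
  obtain ⟨x2, p2⟩ := xstep _ _ 1 8 2 3 7 (by decide) hasNeighbours₁ b1 (by decide) (by decide)
    (by decide) (by decide) (by decide) (by decide) p1 (ρ.t b c d) (by
      rw [u1 8 (by decide) (by decide), u1 2 (by decide) (by decide),
        u1 3 (by decide) (by decide), u1 7 (by decide) (by decide),
        u1 1 (by decide) (by decide), v8, v2, v3, v7, v1]
      have := ρ.rel c d a b
      rw [ρ.cyc b c d, ← ρ.cyc c a b] at this
      rw [this]; ring)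
  have u2 : ∀ u, u ≠ 12 → u ≠ 0 → u ≠ 1 →
      ((S.mutate (idx 0)).mutate (idx 1)).x (idx u) = S.x (idx u) := by
    intro u hu h0 h1
    rw [x2, Function.update_of_ne (hne u 1 hu (by decide) h1), u1 u hu h0]
  have u20 : ((S.mutate (idx 0)).mutate (idx 1)).x (idx 0) = ρ.t a b d := by
    rw [x2, Function.update_of_ne (hne 0 1 (by decide) (by decide) (by decide)), x1,
      Function.update_self]
  have u21 : ((S.mutate (idx 0)).mutate (idx 1)).x (idx 1) = ρ.t b c d := by
    rw [x2, Function.update_self]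
  obtain ⟨x3, p3⟩ := xstep _ _ 2 1 5 6 0 (by decide) hasNeighbours₂ b2 (by decide) (by decide)
    (by decide) (by decide) (by decide) (by decide) p2 (ρ.e b d) (by
      rw [u20, u21, u2 5 (by decide) (by decide) (by decide),
        u2 6 (by decide) (by decide) (by decide), u2 2 (by decide) (by decide) (by decide),
        v5, v6, v2]
      have := ρ.rel b c d a
      rw [ρ.cyc a b c, ρ.cyc a b d] at this
      linear_combination -this)
  have u3 : ∀ u, u ≠ 12 → u ≠ 2 →
      (((S.mutate (idx 0)).mutate (idx 1)).mutate (idx 2)).x (idx u) =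
        ((S.mutate (idx 0)).mutate (idx 1)).x (idx u) := by
    intro u hu h0
    rw [x3, Function.update_of_ne (hne u 2 hu (by decide) h0)]
  obtain ⟨x4, p4⟩ := xstep _ _ 3 0 9 10 1 (by decide) hasNeighbours₃ b3 (by decide) (by decide)
    (by decide) (by decide) (by decide) (by decide) p3 (ρ.e d b) (by
      rw [u3 0 (by decide) (by decide), u3 9 (by decide) (by decide),
        u3 10 (by decide) (by decide), u3 1 (by decide) (by decide),
        u3 3 (by decide) (by decide), u20, u21, u2 9 (by decide) (by decide) (by decide),
        u2 10 (by decide) (by decide) (by decide), u2 3 (by decide) (by decide) (by decide),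
        v9, v10, v3]
      have := ρ.rel d a b c
      rw [ρ.cyc c d a, ← ρ.cyc d a b, ← ρ.cyc d b c] at this
      linear_combination -this)
  rw [← hl']
  refine ⟨hq.rotate.nc, ?_, ?_, ?_, ?_, p4⟩
  · intro i j hij
    have hcij : nodeCode a b c d (l i) = nodeCode a b c d (l j) :=
      flipCode_facts.2.1 (by rw [← code', ← code', hij])
    rcases key i with ⟨h1, h2, h3⟩ | ⟨h1, h2, h3⟩ <;>
      rcases key j with ⟨h1', h2', h3'⟩ | ⟨h1', h2', h3'⟩
    · exact hI.inj (by rw [h2, h2', hcij])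
    · rw [hcij] at h1; exact absurd h1 h1'
    · rw [hcij] at h1; exact absurd h1' h1
    · exact hI.inj (by rw [← h2, ← h2', hij])
  · intro p
    rw [hq.rotate.isNode_iff_nodeName]
    constructor
    · rintro (h | ⟨u, hu, rfl⟩)
      · obtain ⟨i, rfl⟩ := (hI.node _).1 (h.mono le_sup_left)
        refine ⟨i, ?_⟩
        rcases key i with ⟨h1, h2, h3⟩ | ⟨h1, h2, h3⟩
        · exact absurd h (by rw [h2]; exact hq.not_isNode_nodeName h1)
        · exact h2
      · obtain ⟨w, h1, h2, h3⟩ := flipCode_facts.2.2 u (hlt hu)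
        refine ⟨idx w, ?_⟩
        rcases key (idx w) with ⟨h1', h2', h3'⟩ | ⟨h1', h2', h3'⟩
        · rw [h3', hcc w h2, h1]
        · rw [hcc w h2] at h1'
          exact absurd (h3.2 hu) h1'
    · rintro ⟨i, rfl⟩
      rcases key i with ⟨h1, h2, h3⟩ | ⟨h1, h2, h3⟩
      · exact Or.inr ⟨_, hflip4 _ h1, h3⟩
      · rw [h2]; exact Or.inl h3
  · rw [b4]
    funext i j
    rw [hq.rotate.arrowCount_eq, code', code']
    congr 1
    -- A relabelled index names a node outside `G` both before and after, so its counts in `G`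
    -- vanish each time.
    · have hz : ∀ i, (l' i = l i) ∨ (¬ IsNode G (l i) ∧ ¬ IsNode G (l' i)) := by
        intro i
        rcases key i with ⟨h1, h2, h3⟩ | ⟨h1, h2, h3⟩
        · refine Or.inr ⟨?_, ?_⟩
          · rw [h2]; exact hq.not_isNode_nodeName h1
          · rw [h3]; exact hq.rotate.not_isNode_nodeName (hflip4 _ h1)
        · exact Or.inl h2
      rcases hz i with hi | ⟨hi, hi'⟩
      · rcases hz j with hj | ⟨hj, hj'⟩
        · rw [hi, hj]
        · rw [arrowCount_eq_zero_right hj, arrowCount_eq_zero_right hj']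
      · rw [arrowCount_eq_zero_left hi, arrowCount_eq_zero_left hi']
    · exact quadQuiver_flip _ _
  · rw [hl', x4, x3, x2, x1, hI.x, Function.comp_update, Function.comp_update,
      Function.comp_update, Function.comp_update, ← face_rotate a b d, ← face_rotate b d a,
      Realization.val_face ρ hq.bcd, Realization.val_face ρ hq.dab,
      ρ.cyc d a b |>.symm]
    rfl

end Flip

/-- The realization is fixed before the flips are chosen; hence the value at a given label is the
same for all sequences of flips. -/
theorem FlipReachable.invariant {N : ℕ} {G : SimpleGraph (Fin N)} (hG : Noncrossing G)
    {P : Set (Ambient G)} (hP : IsPositiveCone P) (hvar : ∀ p, initialVar G p ∈ P)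
    {ρ : Realization N (Ambient G)} (hρ : ∀ p : QNode G, ρ.val p.1 = initialVar G p)
    {T : SimpleGraph (Fin N)} {l : QNode G → Node N} {S : Seed (QNode G) (Ambient G)}
    (h : FlipReachable G T l S) : FlipInvariant P ρ T l S := by
  induction h with
  | refl =>
    refine ⟨hG, Subtype.val_injective, fun p => ⟨fun h => ⟨⟨p, h⟩, rfl⟩, ?_⟩, rfl, ?_, hvar⟩
    · rintro ⟨i, rfl⟩
      exact i.2
    · funext p
      exact (hρ p).symm
  | flip h habc hcda hp hq hr hs ih =>
    obtain ⟨h1, h2⟩ := isQuad_deleteEdges ih.nc habc hcda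
    rw [← h2] at ih
    exact ih.flip hP h1 hp hq hr hs

/-- Quotients of polynomials that are positive at `(1, …, 1)`. -/
def positiveFractions {N : ℕ} (G : SimpleGraph (Fin N)) : Set (Ambient G) :=
  {x | ∃ p q : MvPolynomial (QNode G) ℚ, 0 < MvPolynomial.eval 1 p ∧ 0 < MvPolynomial.eval 1 q ∧
    x = algebraMap _ (Ambient G) p / algebraMap _ (Ambient G) q}

section Positive

variable {N : ℕ} (G : SimpleGraph (Fin N))

theorem algebraMap_ne_zero_of_eval_pos {p : MvPolynomial (QNode G) ℚ}
    (hp : 0 < MvPolynomial.eval 1 p) :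
    algebraMap (MvPolynomial (QNode G) ℚ) (Ambient G) p ≠ 0 := by
  intro h
  rw [FaithfulSMul.algebraMap_eq_zero_iff] at h
  rw [h, map_zero] at hp
  exact lt_irrefl _ hp

/-- Positivity at `(1, …, 1)` survives addition, multiplication and division of fractions, and it
rules out zero. -/
theorem isPositiveCone_positiveFractions : IsPositiveCone (positiveFractions G) where
  add := by
    rintro _ _ ⟨p, q, hp, hq, rfl⟩ ⟨p', q', hp', hq', rfl⟩
    refine ⟨p * q' + q * p', q * q', ?_, ?_, ?_⟩
    · simp only [map_add, map_mul]; positivity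
    · simp only [map_mul]; positivity
    · rw [div_add_div _ _ (algebraMap_ne_zero_of_eval_pos G hq)
        (algebraMap_ne_zero_of_eval_pos G hq')]
      simp only [map_add, map_mul]
  mul := by
    rintro _ _ ⟨p, q, hp, hq, rfl⟩ ⟨p', q', hp', hq', rfl⟩
    refine ⟨p * p', q * q', ?_, ?_, ?_⟩
    · simp only [map_mul]; positivity
    · simp only [map_mul]; positivity
    · rw [div_mul_div_comm]; simp only [map_mul]
  div := by
    rintro _ _ ⟨p, q, hp, hq, rfl⟩ ⟨p', q', hp', hq', rfl⟩
    refine ⟨p * q', q * p', ?_, ?_, ?_⟩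
    · simp only [map_mul]; positivity
    · simp only [map_mul]; positivity
    · rw [div_div_div_eq]; simp only [map_mul]
  zero := by
    rintro ⟨p, q, hp, hq, h⟩
    exact div_ne_zero (algebraMap_ne_zero_of_eval_pos G hp) (algebraMap_ne_zero_of_eval_pos G hq)
      h.symm

theorem initialVar_mem_positiveFractions (p : QNode G) : initialVar G p ∈ positiveFractions G :=
  ⟨MvPolynomial.X p, 1, by simp, by simp, by simp [initialVar]⟩

theorem initialVar_ne_zero (p : QNode G) : initialVar G p ≠ 0 := fun h =>
  (isPositiveCone_positiveFractions G).zero (h ▸ initialVar_mem_positiveFractions G p)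

end Positive

/-! ## The realization of a fan -/

/-- Vectors and covectors with prescribed values on the edges and faces of a fan. -/
theorem exists_fan_realization {K : Type} [Field K] {q α y : ℕ → K} (r r' : ℕ → K)
    (hq : ∀ i, q i ≠ 0) (hα : ∀ i, α i ≠ 0) (hy : ∀ i, y i ≠ 0) :
    ∃ (e : ℕ → ℕ → K) (t : ℕ → ℕ → ℕ → K),
      (∀ a b c, t b c a = t a b c) ∧
      (∀ a b c d, e a c * t a b d = e a b * t a c d + e a d * t a b c) ∧
      (∀ i, i ≠ 0 → e 0 i = q i ∧ e i 0 = α i ∧ e i (i + 1) = r i ∧ e (i + 1) i = r' i) ∧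
      ∀ i j, i ≠ 0 → i ≤ j →
        t 0 i j = q i * q j * ∑ l ∈ Finset.Ico i j, y l / (q l * q (l + 1)) := by
  obtain ⟨τ, hτ⟩ : ∃ τ : ℕ → K, τ = fun l => y l / (q l * q (l + 1)) := ⟨_, rfl⟩
  have hτ0 : ∀ l, τ l ≠ 0 := fun l => by
    rw [hτ]; exact div_ne_zero (hy l) (mul_ne_zero (hq _) (hq _))
  obtain ⟨T, hT⟩ : ∃ T : ℕ → K, T = fun i => ∑ l ∈ Finset.range i, τ l := ⟨_, rfl⟩
  -- Up to the scale `q i`, `u i` is the point `(T i, P i)` of an affine plane, and `φ i` is, up to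
  -- the scale `α i`, a line through it of slope `s i - A i`. Here `s i` is the slope of the chord
  -- from point `i` to point `i + 1`. The values `r i` and `r' i` prescribe how far the lines at the
  -- two ends deviate from this chord, by `A i` and `B i`, which forces the recursion `s (i + 1) - A
  -- (i + 1) = s i + B i`.
  obtain ⟨A, hA⟩ : ∃ A : ℕ → K, A = fun i => r i / (q (i + 1) * α i * τ i) := ⟨_, rfl⟩
  obtain ⟨B, hB⟩ : ∃ B : ℕ → K, B = fun i => r' i / (q i * α (i + 1) * τ i) := ⟨_, rfl⟩
  obtain ⟨s, hs⟩ : ∃ s : ℕ → K, s = fun i => ∑ l ∈ Finset.range i, (A (l + 1) + B l) := ⟨_, rfl⟩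
  obtain ⟨P, hP⟩ : ∃ P : ℕ → K, P = fun i => ∑ l ∈ Finset.range i, s l * τ l := ⟨_, rfl⟩
  have hT' : ∀ i, T (i + 1) = T i + τ i := fun i => by rw [hT]; exact Finset.sum_range_succ _ _
  have hs' : ∀ i, s (i + 1) = s i + (A (i + 1) + B i) := fun i => by
    rw [hs]; exact Finset.sum_range_succ _ _
  have hP' : ∀ i, P (i + 1) = P i + s i * τ i := fun i => by
    rw [hP]; exact Finset.sum_range_succ _ _
  have hA' : ∀ i, q (i + 1) * α i * τ i * A i = r i := fun i => by
    rw [hA]; exact mul_div_cancel₀ _ (mul_ne_zero (mul_ne_zero (hq _) (hα _)) (hτ0 _))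
  have hB' : ∀ i, q i * α (i + 1) * τ i * B i = r' i := fun i => by
    rw [hB]; exact mul_div_cancel₀ _ (mul_ne_zero (mul_ne_zero (hq _) (hα _)) (hτ0 _))
  obtain ⟨u, hu0, hu⟩ : ∃ u : ℕ → Fin 3 → K, u 0 = ![1, 0, 0] ∧
      ∀ i, i ≠ 0 → u i = ![q i * P i, q i, q i * T i] :=
    ⟨fun i => if i = 0 then ![1, 0, 0] else ![q i * P i, q i, q i * T i], by simp,
      fun i hi => by simp [hi]⟩
  obtain ⟨φ, hφ0, hφ⟩ : ∃ φ : ℕ → Fin 3 → K, φ 0 = ![0, 1, 0] ∧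
      ∀ i, i ≠ 0 → φ i = ![α i, α i * (-P i - (A i - s i) * T i), α i * (A i - s i)] :=
    ⟨fun i => if i = 0 then ![0, 1, 0] else
      ![α i, α i * (-P i - (A i - s i) * T i), α i * (A i - s i)], by simp,
      fun i hi => by simp [hi]⟩
  obtain ⟨e, he⟩ : ∃ e : ℕ → ℕ → K, ∀ i j,
      e i j = φ i 0 * u j 0 + φ i 1 * u j 1 + φ i 2 * u j 2 := ⟨_, fun _ _ => rfl⟩
  obtain ⟨t, ht⟩ : ∃ t : ℕ → ℕ → ℕ → K, ∀ i j k, t i j k =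
      u i 0 * (u j 1 * u k 2 - u j 2 * u k 1) + u i 1 * (u j 2 * u k 0 - u j 0 * u k 2) +
        u i 2 * (u j 0 * u k 1 - u j 1 * u k 0) := ⟨_, fun _ _ _ => rfl⟩
  have hee : ∀ i, e i i = 0 := by
    intro i
    by_cases hi : i = 0
    · subst hi; simp [he, hu0, hφ0]
    · simp [he, hu i hi, hφ i hi]; ring
  refine ⟨e, t, ?_, ?_, ?_, ?_⟩
  · intro a b c
    simp only [ht]; ring
  · intro a b c d
    have h := hee a
    simp only [he, ht] at h ⊢
    linear_combination -(u b 0 * (u c 1 * u d 2 - u c 2 * u d 1) +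
      u b 1 * (u c 2 * u d 0 - u c 0 * u d 2) + u b 2 * (u c 0 * u d 1 - u c 1 * u d 0)) * h
  · intro i hi
    have hi' := Nat.succ_ne_zero i
    refine ⟨?_, ?_, ?_, ?_⟩
    · simp [he, hu i hi, hφ0]
    · simp [he, hu0, hφ i hi]
    · simp only [he, hφ i hi, hu (i + 1) hi', Matrix.cons_val, hP', hT', ← hA' i]; ring
    · simp only [he, hφ (i + 1) hi', hu i hi, Matrix.cons_val, hP', hT', hs', ← hB' i]; ring
  · intro i j hi hij
    have hj : j ≠ 0 := by omega
    -- As `u 0` is the first basis vector, the determinant is `q i * q j * (T j - T i)`, a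
    -- difference of partial sums.
    rw [Finset.sum_Ico_eq_sub _ hij]
    have : ∀ i, ∑ l ∈ Finset.range i, y l / (q l * q (l + 1)) = T i := fun i => by rw [hT, hτ]
    rw [this, this]
    simp only [ht, hu0, hu i hi, hu j hj, Matrix.cons_val]; ring

/-! ## Fan triangulations -/

section Fan

variable {n : ℕ} (v : Fin (n + 3))

/-- The `i`-th vertex counterclockwise from `v`. -/
def vtx (i : ℕ) : Fin (n + 3) := v + Fin.ofNat (n + 3) i

theorem vtx_val {i : ℕ} (hi : i < n + 3) :
    (vtx v i).val = if v.val + i < n + 3 then v.val + i else v.val + i - (n + 3) := by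
  have := v.2
  simp only [vtx, Fin.val_add, Fin.ofNat, Nat.mod_eq_of_lt hi]
  split_ifs with h
  · exact Nat.mod_eq_of_lt h
  · rw [Nat.mod_eq_sub_mod (by omega), Nat.mod_eq_of_lt (by omega)]

theorem vtx_zero : vtx v 0 = v := by
  apply Fin.ext; rw [vtx_val v (by omega), if_pos (by have := v.2; omega)]; omega

theorem vtx_one : vtx v 1 = v + 1 := rfl

theorem vtx_last : vtx v (n + 2) = v - 1 := by
  rw [vtx, sub_eq_add_neg]
  congr 1

theorem exists_vtx (w : Fin (n + 3)) : ∃ i < n + 3, w = vtx v i := by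
  have hv := v.2
  have hw := w.2
  by_cases h : v.val ≤ w.val
  · refine ⟨w.val - v.val, by omega, Fin.ext ?_⟩
    rw [vtx_val v (by omega)]; split_ifs <;> omega
  · refine ⟨w.val + (n + 3) - v.val, by omega, Fin.ext ?_⟩
    rw [vtx_val v (by omega)]; split_ifs <;> omega

variable {v}

theorem vtx_inj {i j : ℕ} (hi : i < n + 3) (hj : j < n + 3) : vtx v i = vtx v j ↔ i = j := by
  rw [Fin.ext_iff, vtx_val v hi, vtx_val v hj]
  have := v.2
  split_ifs <;> omega

theorem sbtw_vtx {i j k : ℕ} (hi : i < n + 3) (hj : j < n + 3) (hk : k < n + 3) :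
    sbtw (vtx v i) (vtx v j) (vtx v k) ↔ i < j ∧ j < k ∨ j < k ∧ k < i ∨ k < i ∧ i < j := by
  rw [Fin.sbtw_iff, Fin.lt_def, Fin.lt_def, Fin.lt_def, vtx_val v hi, vtx_val v hj, vtx_val v hk]
  have := v.2
  split_ifs <;> omega

theorem isBoundary_vtx {i j : ℕ} (hi : i < n + 3) (hj : j < n + 3) :
    IsBoundary (vtx v i) (vtx v j) ↔
      i + 1 = j ∨ j + 1 = i ∨ (i = 0 ∧ j = n + 2) ∨ (j = 0 ∧ i = n + 2) := by
  have hs : ∀ a b : Fin (n + 3), (a - b).val = 1 ↔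
      a.val = b.val + 1 ∨ (a.val = 0 ∧ b.val = n + 2) := by
    intro a b
    have ha := a.2
    have hb := b.2
    rw [Fin.sub_def]
    simp only
    by_cases h : b.val ≤ a.val
    · rw [Nat.mod_eq_sub_mod (by omega), Nat.mod_eq_of_lt (by omega)]; omega
    · rw [Nat.mod_eq_of_lt (by omega)]; omega
  rw [IsBoundary, SimpleGraph.cycleGraph_adj', hs, hs, vtx_val v hi, vtx_val v hj]
  have := v.2
  split_ifs <;> omega

/-- All diagonals at `v` and all boundary segments. -/
def fanGraph (v : Fin (n + 3)) : SimpleGraph (Fin (n + 3)) where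
  Adj a b := a ≠ b ∧ (a = v ∨ b = v ∨ IsBoundary a b)
  symm := ⟨fun a b h => ⟨h.1.symm, by
    rcases h.2 with h | h | h
    · exact Or.inr (Or.inl h)
    · exact Or.inl h
    · exact Or.inr (Or.inr (SimpleGraph.Adj.symm h))⟩⟩
  loopless := ⟨fun a h => h.1 rfl⟩

theorem fanGraph_adj_vtx {i j : ℕ} (hi : i < n + 3) (hj : j < n + 3) :
    (fanGraph v).Adj (vtx v i) (vtx v j) ↔
      i ≠ j ∧ (i = 0 ∨ j = 0 ∨ i + 1 = j ∨ j + 1 = i) := by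
  change vtx v i ≠ vtx v j ∧ (vtx v i = v ∨ vtx v j = v ∨ IsBoundary (vtx v i) (vtx v j)) ↔ _
  have h0 : ∀ {i}, i < n + 3 → (vtx v i = v ↔ i = 0) := fun {i} hi => by
    conv_lhs => rhs; rw [← vtx_zero v]
    exact vtx_inj hi (by omega)
  rw [isBoundary_vtx hi hj, h0 hi, h0 hj, Ne, vtx_inj hi hj]
  omega

theorem noncrossing_fanGraph (v : Fin (n + 3)) : Noncrossing (fanGraph v) := by
  intro a b c d h1 h2
  obtain ⟨i, hi, rfl⟩ := exists_vtx v a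
  obtain ⟨j, hj, rfl⟩ := exists_vtx v b
  obtain ⟨k, hk, rfl⟩ := exists_vtx v c
  obtain ⟨l, hl, rfl⟩ := exists_vtx v d
  rw [sbtw_vtx hi hj hk] at h1
  rw [sbtw_vtx hk hl hi] at h2
  rw [fanGraph_adj_vtx hi hk, fanGraph_adj_vtx hj hl]
  omega

/-- The fan condition puts `Δ` inside `fanGraph v`, which is noncrossing; maximality gives equality.
-/
theorem eq_fanGraph {Δ : SimpleGraph (Fin (n + 3))} (hΔ : IsTriangulation Δ) (hv : IsFanAt Δ v) :
    Δ = fanGraph v := by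
  have hle : Δ ≤ fanGraph v := by
    intro a b hab
    refine ⟨hab.ne, ?_⟩
    by_cases h : IsBoundary a b
    · exact Or.inr (Or.inr h)
    · rcases hv a b hab h with h | h
      · exact Or.inl h
      · exact Or.inr (Or.inl h)
  exact le_antisymm hle (hΔ.2 (noncrossing_fanGraph v) hle)

theorem isTriangle_fanGraph_vtx {i j k : ℕ} (hi : i < n + 3) (hj : j < n + 3) (hk : k < n + 3) :
    IsTriangle (fanGraph v) (vtx v i) (vtx v j) (vtx v k) ↔
      (i = 0 ∧ j ≠ 0 ∧ k = j + 1) ∨ (j = 0 ∧ k ≠ 0 ∧ i = k + 1) ∨ (k = 0 ∧ i ≠ 0 ∧ j = i + 1) := by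
  rw [IsTriangle, sbtw_vtx hi hj hk, fanGraph_adj_vtx hi hj, fanGraph_adj_vtx hj hk,
    fanGraph_adj_vtx hk hi]
  omega

/-- The node of the directed edge from the `i`-th to the `j`-th vertex. -/
abbrev edgeNode (v : Fin (n + 3)) (i j : ℕ) : Node (n + 3) := .edge (vtx v i) (vtx v j)

/-- The node of the `i`-th triangle of the fan. -/
abbrev faceNode (v : Fin (n + 3)) (i : ℕ) : Node (n + 3) :=
  .face {vtx v 0, vtx v i, vtx v (i + 1)}

theorem isNode_fanGraph {p : Node (n + 3)} (hp : IsNode (fanGraph v) p) :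
    (∃ i, i ≠ 0 ∧ i < n + 3 ∧ p = edgeNode v 0 i) ∨ (∃ i, i ≠ 0 ∧ i < n + 3 ∧ p = edgeNode v i 0) ∨
    (∃ i, i ≠ 0 ∧ i + 1 < n + 3 ∧ p = edgeNode v i (i + 1)) ∨
    (∃ i, i ≠ 0 ∧ i + 1 < n + 3 ∧ p = edgeNode v (i + 1) i) ∨
    (∃ i, i ≠ 0 ∧ i + 1 < n + 3 ∧ p = faceNode v i) := by
  cases hp with
  | @edge a b h =>
    obtain ⟨i, hi, rfl⟩ := exists_vtx v a
    obtain ⟨j, hj, rfl⟩ := exists_vtx v b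
    rw [fanGraph_adj_vtx hi hj] at h
    obtain ⟨h1, h2⟩ := h
    by_cases h3 : i = 0
    · subst h3; exact Or.inl ⟨j, h1.symm, hj, rfl⟩
    by_cases h4 : j = 0
    · subst h4; exact Or.inr (Or.inl ⟨i, h1, hi, rfl⟩)
    by_cases h5 : i + 1 = j
    · subst h5; exact Or.inr (Or.inr (Or.inl ⟨i, h3, hj, rfl⟩))
    · obtain rfl : j + 1 = i := by omega
      exact Or.inr (Or.inr (Or.inr (Or.inl ⟨j, h4, hi, rfl⟩)))
  | @face a b c h =>
    obtain ⟨i, hi, rfl⟩ := exists_vtx v a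
    obtain ⟨j, hj, rfl⟩ := exists_vtx v b
    obtain ⟨k, hk, rfl⟩ := exists_vtx v c
    rw [isTriangle_fanGraph_vtx hi hj hk] at h
    refine Or.inr (Or.inr (Or.inr (Or.inr ?_)))
    rcases h with ⟨rfl, h, rfl⟩ | ⟨rfl, h, rfl⟩ | ⟨rfl, h, rfl⟩
    · exact ⟨j, h, hk, rfl⟩
    · exact ⟨k, h, hi, by rw [← face_rotate]⟩
    · exact ⟨i, h, hj, by rw [← face_rotate, ← face_rotate]⟩

theorem fanFace_eq (v : Fin (n + 3)) :
    fanFace v = {vtx v 0, vtx v 1, vtx v (n + 2)} := by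
  rw [fanFace, vtx_zero, vtx_one, vtx_last]
  exact (face_rotate _ _ _).symm

end Fan

/-! ## The variable of the fan face -/

section FanVariable

variable {n : ℕ} {v : Fin (n + 3)}

open Classical in
/-- The initial variable at a node, or `1` if there is no such node. -/
def varAt {N : ℕ} (G : SimpleGraph (Fin N)) (p : Node N) : Ambient G :=
  -- The default 1 keeps families indexed by all of `ℕ` free of zeros, as `exists_fan_realization`
  -- requires.
  if h : IsNode G p then initialVar G ⟨p, h⟩ else 1

theorem varAt_of_isNode {N : ℕ} {G : SimpleGraph (Fin N)} (p : QNode G) :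
    varAt G p.1 = initialVar G p := dif_pos p.2

theorem varAt_ne_zero {N : ℕ} (G : SimpleGraph (Fin N)) (p : Node N) : varAt G p ≠ 0 := by
  unfold varAt
  split_ifs
  · exact initialVar_ne_zero G _
  · exact one_ne_zero

theorem exists_realization (v : Fin (n + 3)) :
    ∃ ρ : Realization (n + 3) (Ambient (fanGraph v)),
      (∀ p : QNode (fanGraph v), ρ.val p.1 = initialVar _ p) ∧
      ρ.val (.face (fanFace v)) =
        varAt (fanGraph v) (edgeNode v 0 1) * varAt (fanGraph v) (edgeNode v 0 (n + 2)) *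
        ∑ l ∈ Finset.Ico 1 (n + 2), varAt (fanGraph v) (faceNode v l) /
          (varAt (fanGraph v) (edgeNode v 0 l) * varAt (fanGraph v) (edgeNode v 0 (l + 1))) := by
  obtain ⟨e, t, hcyc, hrel, he, ht⟩ := exists_fan_realization
    (q := fun i => varAt (fanGraph v) (edgeNode v 0 i))
    (α := fun i => varAt (fanGraph v) (edgeNode v i 0))
    (y := fun i => varAt (fanGraph v) (faceNode v i))
    (fun i => varAt (fanGraph v) (edgeNode v i (i + 1)))
    (fun i => varAt (fanGraph v) (edgeNode v (i + 1) i))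
    (fun i => varAt_ne_zero _ _) (fun i => varAt_ne_zero _ _) (fun i => varAt_ne_zero _ _)
  choose idx hidx1 hidx2 using exists_vtx v
  have hidx : ∀ {i}, i < n + 3 → idx (vtx v i) = i := fun {i} hi =>
    ((vtx_inj hi (hidx1 _)).1 (hidx2 (vtx v i))).symm
  refine ⟨⟨fun a b => e (idx a) (idx b), fun a b c => t (idx a) (idx b) (idx c),
    fun _ _ _ => hcyc _ _ _, fun _ _ _ _ => hrel _ _ _ _⟩, ?_, ?_⟩
  · rintro ⟨p, hp⟩
    rw [← varAt_of_isNode]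
    rcases isNode_fanGraph hp with ⟨i, h1, h2, rfl⟩ | ⟨i, h1, h2, rfl⟩ | ⟨i, h1, h2, rfl⟩ |
      ⟨i, h1, h2, rfl⟩ | ⟨i, h1, h2, rfl⟩
    · simp only [Realization.val]
      rw [hidx (by omega), hidx h2, (he i h1).1]
    · simp only [Realization.val]
      rw [hidx h2, hidx (by omega), (he i h1).2.1]
    · simp only [Realization.val]
      rw [hidx (by omega), hidx h2, (he i h1).2.2.1]
    · simp only [Realization.val]
      rw [hidx (by omega), hidx (by omega), (he i h1).2.2.2]
    · rw [Realization.val_face _ ((sbtw_vtx (by omega) (by omega) h2).2 (by omega))]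
      simp only
      rw [hidx (by omega), hidx (by omega), hidx h2, ht i _ h1 (Nat.le_succ i),
        Nat.Ico_succ_singleton, Finset.sum_singleton, mul_div_cancel₀]
      exact mul_ne_zero (varAt_ne_zero _ _) (varAt_ne_zero _ _)
  · rw [fanFace_eq,
      Realization.val_face _ ((sbtw_vtx (by omega) (by omega) (by omega)).2 (by omega))]
    simp only
    rw [hidx (by omega), hidx (by omega), hidx (by omega), ht _ _ one_ne_zero (by omega)]

/-- The right-hand side does not mention the flips, which is the uniqueness of the variable. -/
theorem IsFaceVariable.eq {x : Ambient (fanGraph v)}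
    (hx : IsFaceVariable (fanGraph v) (fanFace v) x) :
    x = varAt (fanGraph v) (edgeNode v 0 1) * varAt (fanGraph v) (edgeNode v 0 (n + 2)) *
        ∑ l ∈ Finset.Ico 1 (n + 2), varAt (fanGraph v) (faceNode v l) /
          (varAt (fanGraph v) (edgeNode v 0 l) * varAt (fanGraph v) (edgeNode v 0 (l + 1))) := by
  obtain ⟨T, l, S, h, p, hp, rfl⟩ := hx
  obtain ⟨ρ, h1, h2⟩ := exists_realization v
  have hI := h.invariant (noncrossing_fanGraph v) (isPositiveCone_positiveFractions _)
    (initialVar_mem_positiveFractions _) h1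
  rw [hI.x, Function.comp_apply, hp, h2]

theorem flipGraph_adj_of_adj {N : ℕ} {T : SimpleGraph (Fin N)} {a b c d x y : Fin N}
    (h : T.Adj x y) (h1 : ¬ (x = a ∧ y = c)) (h2 : ¬ (x = c ∧ y = a)) :
    (flipGraph T a b c d).Adj x y := by
  refine Or.inl (SimpleGraph.deleteEdges_adj.2 ⟨h, ?_⟩)
  rw [Set.mem_singleton_iff, Sym2.eq_iff]
  tauto

/-- The diagonals from `v` to `v + 2`, `v + 3`, … are flipped in turn. The triangle on the side from
`v` to `v + 1` widens by one vertex each time, while the fan beyond it is untouched. -/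
theorem exists_flipReachable (v : Fin (n + 3)) (j : ℕ) (hj : j ≤ n) :
    ∃ T l S, FlipReachable (fanGraph v) T l S ∧
      IsTriangle T (vtx v 0) (vtx v 1) (vtx v (j + 2)) ∧
      ∀ i, j + 2 ≤ i → i + 1 < n + 3 → IsTriangle T (vtx v 0) (vtx v i) (vtx v (i + 1)) := by
  induction j with
  | zero =>
    refine ⟨_, _, _, .refl, ?_, fun i h1 h2 => ?_⟩
    · rw [isTriangle_fanGraph_vtx (by omega) (by omega) (by omega)]; omega
    · rw [isTriangle_fanGraph_vtx (by omega) (by omega) (by omega)]; omega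
  | succ j ih =>
    obtain ⟨T, l, S, h, h1, h2⟩ := ih (by omega)
    obtain ⟨ρ, hρ, -⟩ := exists_realization v
    have hI := h.invariant (noncrossing_fanGraph v) (isPositiveCone_positiveFractions _)
      (initialVar_mem_positiveFractions _) hρ
    have h3 := (h2 (j + 2) le_rfl (by omega))
    have h4 := h3.rotate
    obtain ⟨p, hp⟩ := (hI.node _).1 (.edge h1.2.2.2.symm)
    obtain ⟨q, hq⟩ := (hI.node _).1 (.edge h1.2.2.2)
    obtain ⟨r, hr⟩ := (hI.node _).1 (.face h1)
    obtain ⟨s, hs⟩ := (hI.node _).1 (.face h4)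
    refine ⟨_, _, _, .flip h h1 h4 hp hq hr hs, ⟨?_, ?_, ?_, ?_⟩, fun i h5 h6 => ?_⟩
    · rw [sbtw_vtx (by omega) (by omega) (by omega)]; omega
    · refine flipGraph_adj_of_adj h1.2.1 ?_ ?_ <;>
      · rw [vtx_inj (by omega) (by omega), vtx_inj (by omega) (by omega)]; omega
    · refine Or.inr ?_
      rw [SimpleGraph.edge_adj]
      refine ⟨Or.inl ⟨rfl, rfl⟩, fun h => ?_⟩
      rw [vtx_inj (by omega) (by omega)] at h
      omega
    · refine flipGraph_adj_of_adj h3.2.2.2 ?_ ?_ <;>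
      · rw [vtx_inj (by omega) (by omega), vtx_inj (by omega) (by omega)]; omega
    · obtain ⟨e1, e2, e3, e4⟩ := h2 i (by omega) h6
      refine ⟨e1, flipGraph_adj_of_adj e2 ?_ ?_, flipGraph_adj_of_adj e3 ?_ ?_,
        flipGraph_adj_of_adj e4 ?_ ?_⟩ <;>
      · rw [vtx_inj (by omega) (by omega), vtx_inj (by omega) (by omega)]; omega

theorem exists_isFaceVariable (v : Fin (n + 3)) :
    ∃ x, IsFaceVariable (fanGraph v) (fanFace v) x := by
  obtain ⟨T, l, S, h, h1, -⟩ := exists_flipReachable v n le_rfl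
  obtain ⟨ρ, hρ, -⟩ := exists_realization v
  have hI := h.invariant (noncrossing_fanGraph v) (isPositiveCone_positiveFractions _)
    (initialVar_mem_positiveFractions _) hρ
  obtain ⟨p, hp⟩ := (hI.node _).1 (.face h1)
  exact ⟨S.x p, T, l, S, h, p, by rw [hp, fanFace_eq], rfl⟩

end FanVariable

/-! ## Laurent expansions -/

section Laurent

variable {N : ℕ} {G : SimpleGraph (Fin N)}

theorem laurentMonomial_add (m m' : QNode G → ℤ) :
    laurentMonomial G (m + m') = laurentMonomial G m * laurentMonomial G m' := by
  rw [laurentMonomial, laurentMonomial, laurentMonomial, ← Finset.prod_mul_distrib]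
  exact Finset.prod_congr rfl fun p _ => zpow_add₀ (initialVar_ne_zero G p) _ _

theorem laurentMonomial_sub (m m' : QNode G → ℤ) :
    laurentMonomial G (m - m') = laurentMonomial G m / laurentMonomial G m' := by
  rw [laurentMonomial, laurentMonomial, laurentMonomial, ← Finset.prod_div_distrib]
  exact Finset.prod_congr rfl fun p _ => zpow_sub₀ (initialVar_ne_zero G p) _ _

theorem laurentMonomial_of_nonneg {m : QNode G → ℤ} (hm : ∀ p, 0 ≤ m p) :
    laurentMonomial G m = algebraMap (MvPolynomial (QNode G) ℚ) (Ambient G)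
      (MvPolynomial.monomial (Finsupp.equivFunOnFinite.symm fun p => (m p).toNat) 1) := by
  rw [MvPolynomial.monomial_eq, map_one, one_mul, Finsupp.prod_fintype _ _ (fun _ => pow_zero _),
    map_prod, laurentMonomial]
  refine Finset.prod_congr rfl fun p _ => ?_
  rw [map_pow, Finsupp.equivFunOnFinite_symm_apply_apply, ← zpow_natCast, Int.toNat_of_nonneg (hm p)]
  rfl

/-- Multiplication by one monomial clears all negative exponents, and distinct monomials of a
polynomial ring are independent. -/
theorem linearIndependent_laurentMonomial : LinearIndependent ℤ (laurentMonomial G) := by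
  rw [linearIndependent_iff]
  intro P hP
  obtain ⟨s, hs⟩ : ∃ s : QNode G → ℤ, ∀ m ∈ P.support, ∀ p, 0 ≤ (m + s) p := by
    -- The sum of all `|m p|` dominates each `-m p`.
    refine ⟨fun p => ∑ m ∈ P.support, |m p|, fun m hm p => ?_⟩
    have h1 := Finset.single_le_sum (f := fun m : QNode G → ℤ => |m p|)
      (fun _ _ => abs_nonneg _) hm
    have h2 := neg_abs_le (m p)
    simp only [Pi.add_apply]
    omega
  obtain ⟨f, hf⟩ : ∃ f : (QNode G → ℤ) → (QNode G →₀ ℕ), ∀ m, f m =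
      Finsupp.equivFunOnFinite.symm fun p => ((m + s) p).toNat := ⟨_, fun _ => rfl⟩
  have h1 : algebraMap (MvPolynomial (QNode G) ℚ) (Ambient G)
      (∑ m ∈ P.support, P m • MvPolynomial.monomial (f m) 1) = 0 := by
    rw [Finsupp.linearCombination_apply, Finsupp.sum] at hP
    rw [map_sum, ← zero_mul (laurentMonomial G s), ← hP, Finset.sum_mul]
    refine Finset.sum_congr rfl fun m hm => ?_
    rw [smul_mul_assoc, ← laurentMonomial_add, laurentMonomial_of_nonneg (hs m hm), map_zsmul, hf]
  rw [FaithfulSMul.algebraMap_eq_zero_iff] at h1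
  ext m
  by_contra hm
  have hm' : m ∈ P.support := by simpa using hm
  have h2 := congrArg (MvPolynomial.coeff (f m)) h1
  rw [MvPolynomial.coeff_sum, Finset.sum_eq_single m, MvPolynomial.coeff_zero,
    zsmul_eq_mul] at h2
  · rw [← map_intCast (MvPolynomial.C (σ := QNode G) (R := ℚ)), MvPolynomial.coeff_C_mul, MvPolynomial.coeff_monomial,
      if_pos rfl, mul_one] at h2
    exact hm (by exact_mod_cast h2)
  · intro m' hm1 hne
    rw [zsmul_eq_mul, ← map_intCast (MvPolynomial.C (σ := QNode G) (R := ℚ)), MvPolynomial.coeff_C_mul,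
      MvPolynomial.coeff_monomial, if_neg, mul_zero]
    intro e
    refine hne (funext fun p => ?_)
    have e' := DFunLike.congr_fun e p
    rw [hf, hf, Finsupp.equivFunOnFinite_symm_apply_apply,
      Finsupp.equivFunOnFinite_symm_apply_apply] at e'
    have h3 := hs m hm' p
    have h4 := hs m' hm1 p
    simp only [Pi.add_apply] at e' h3 h4
    omega
  · exact fun h => absurd hm' h

theorem isLaurentExpansion_iff {x : Ambient G} {P : (QNode G → ℤ) →₀ ℤ} :
    IsLaurentExpansion G x P ↔ x = Finsupp.linearCombination ℤ (laurentMonomial G) P := by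
  rw [IsLaurentExpansion, Finsupp.linearCombination_apply]
  simp only [zsmul_eq_mul]

/-- Independence makes the expansion unique, and distinct exponents with coefficient 1 cannot
cancel. -/
theorem expansionMonomials_sum {ι : Type} {s : Finset ι} {f : ι → QNode G → ℤ}
    (hf : Set.InjOn f s) :
    expansionMonomials G (∑ i ∈ s, laurentMonomial G (f i)) = f '' s := by
  classical
  have hexp : ∑ i ∈ s, laurentMonomial G (f i) = Finsupp.linearCombination ℤ (laurentMonomial G)
      (∑ i ∈ s, Finsupp.single (f i) 1) := by
    rw [map_sum]
    exact Finset.sum_congr rfl fun i _ => by rw [Finsupp.linearCombination_single, one_smul]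
  have hcoef : ∀ m, (∑ i ∈ s, Finsupp.single (f i) (1 : ℤ)) m ≠ 0 ↔ m ∈ f '' s := by
    intro m
    rw [Finsupp.finsetSum_apply]
    constructor
    · intro h
      obtain ⟨i, hi, h'⟩ := Finset.exists_ne_zero_of_sum_ne_zero h
      refine ⟨i, hi, ?_⟩
      by_contra hne
      exact h' (Finsupp.single_eq_of_ne (Ne.symm hne))
    · rintro ⟨i, hi, rfl⟩
      rw [Finset.sum_eq_single i]
      · simp
      · intro j hj hne
        exact Finsupp.single_eq_of_ne fun e => hne (hf hj hi e.symm)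
      · exact fun h => absurd hi h
  ext m
  rw [← hcoef]
  constructor
  · rintro ⟨P, hP, hm⟩
    rw [isLaurentExpansion_iff, hexp] at hP
    rwa [linearIndependent_laurentMonomial hP]
  · intro hm
    exact ⟨_, isLaurentExpansion_iff.2 hexp, hm⟩

/-- The exponent vector of the variable at a node. -/
def nodeExp (G : SimpleGraph (Fin N)) (p : Node N) : QNode G → ℤ := fun q =>
  if q.1 = p then 1 else 0

theorem laurentMonomial_nodeExp (p : Node N) : laurentMonomial G (nodeExp G p) = varAt G p := by
  unfold laurentMonomial nodeExp varAt
  split_ifs with h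
  · rw [Finset.prod_eq_single ⟨p, h⟩]
    · simp
    · intro q _ hq
      rw [if_neg (fun e => hq (Subtype.ext e)), zpow_zero]
    · exact fun h => absurd (Finset.mem_univ _) h
  · refine Finset.prod_eq_one fun q _ => ?_
    rw [if_neg (show ¬ q.1 = p from fun e => h (e ▸ q.2)), zpow_zero]

/-- Ensures that an arrow gives a nonzero signed count. Opposite arrows would require both cyclic
orientations of the same three vertices, or two different counterclockwise orders of one face. -/
theorem Arrow.asymm {p q : Node N} (h : Arrow G p q) : ¬ Arrow G q p := by
  have key : ∀ {a b c : Fin N}, IsTriangle G a b c → ∀ {s : Finset (Fin N)}, s = {a, b, c} →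
      ¬ Arrow G (.face s) (.edge a c) := by
    intro a b c h s hs h'
    obtain ⟨n1, n2, n3⟩ := ne_of_sbtw h.1
    cases h' with
    | outward h' =>
      rcases isRotation_of_face_eq h.1 h'.1 hs with e | e | e
      · exact n2 e.2.1.symm
      · exact n1 e.1
      · exact n3 e.1.symm
  have key' : ∀ {a b c : Fin N}, IsTriangle G a b c → ∀ {s : Finset (Fin N)}, s = {a, b, c} →
      ¬ Arrow G (.edge a b) (.face s) := by
    intro a b c h s hs h'
    obtain ⟨n1, n2, n3⟩ := ne_of_sbtw h.1
    cases h' with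
    | inward h' =>
      rcases isRotation_of_face_eq h.1 h'.1 hs with e | e | e
      · exact n2 e.2.2
      · exact n1 e.1
      · exact n3 e.1.symm
  cases h with
  | across h =>
    intro h'
    cases h' with
    | across h' =>
      have h1 := h.1
      have h2 := h'.1
      rw [Fin.sbtw_iff] at h1 h2
      omega
  | inward h => exact key h rfl
  | outward h => exact key' h rfl

theorem yhat_ne_zero {k p : QNode G} (h : Arrow G p.1 k.1 ∨ Arrow G k.1 p.1) :
    yhat G k p ≠ 0 := by
  rcases h with h | h
  · simp [yhat, initialQuiver, h, h.asymm]
  · simp [yhat, initialQuiver, h, h.asymm]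

end Laurent

/-! ## The expansion poset of the fan face -/

section Poset

variable {n : ℕ} {v : Fin (n + 3)}

/-- The exponent vectors of the terms in the expansion of the variable of the fan face. -/
def fanExp (v : Fin (n + 3)) (l : ℕ) : QNode (fanGraph v) → ℤ :=
  nodeExp _ (edgeNode v 0 1) + nodeExp _ (edgeNode v 0 (n + 2)) + (nodeExp _ (faceNode v l) -
    (nodeExp _ (edgeNode v 0 l) + nodeExp _ (edgeNode v 0 (l + 1))))

theorem IsFaceVariable.eq_sum {x : Ambient (fanGraph v)}
    (hx : IsFaceVariable (fanGraph v) (fanFace v) x) :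
    x = ∑ l ∈ Finset.Ico 1 (n + 2), laurentMonomial (fanGraph v) (fanExp v l) := by
  rw [hx.eq, Finset.mul_sum]
  refine Finset.sum_congr rfl fun l _ => ?_
  simp only [fanExp, laurentMonomial_add, laurentMonomial_sub, laurentMonomial_nodeExp]

theorem isNode_faceNode {l : ℕ} (h0 : l ≠ 0) (hl : l + 1 < n + 3) :
    IsNode (fanGraph v) (faceNode v l) :=
  .face ((isTriangle_fanGraph_vtx (by omega) (by omega) hl).2 (by omega))

theorem faceNode_inj {i j : ℕ} (hi0 : i ≠ 0) (hi : i + 1 < n + 3) (hj0 : j ≠ 0)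
    (hj : j + 1 < n + 3) : faceNode v i = faceNode v j ↔ i = j := by
  constructor
  · intro h
    rw [Node.face.injEq] at h
    have h1 : vtx v i ∈ ({vtx v 0, vtx v j, vtx v (j + 1)} : Finset _) := by rw [← h]; simp
    have h2 : vtx v (i + 1) ∈ ({vtx v 0, vtx v j, vtx v (j + 1)} : Finset _) := by
      rw [← h]; simp
    simp only [Finset.mem_insert, Finset.mem_singleton] at h1 h2
    rw [vtx_inj (by omega) (by omega), vtx_inj (by omega) (by omega),
      vtx_inj (by omega) (by omega)] at h1 h2
    omega
  · rintro rfl; rfl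

/-- The exponents at face nodes identify the term: `y_l` occurs in the `l`-th one only. -/
theorem fanExp_face {q : QNode (fanGraph v)} {i j : ℕ} (hi0 : i ≠ 0) (hi : i + 1 < n + 3)
    (hj0 : j ≠ 0) (hj : j + 1 < n + 3) (hq : q.1 = faceNode v j) :
    fanExp v i q = if j = i then 1 else 0 := by
  simp only [fanExp, nodeExp, Pi.add_apply, Pi.sub_apply, hq, faceNode_inj hj0 hj hi0 hi]
  simp

theorem fanExp_edge {l : ℕ} {q : QNode (fanGraph v)} {i j : ℕ} (hi0 : i ≠ 0) (hi : i < n + 3)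
    (hq : q.1 = edgeNode v i j) : fanExp v l q = 0 := by
  have h0 : ¬ vtx v i = vtx v 0 := by rw [vtx_inj hi (by omega)]; exact hi0
  simp [fanExp, nodeExp, hq, h0]

theorem fanExp_injOn : Set.InjOn (fanExp v) (Finset.Ico 1 (n + 2) : Finset ℕ) := by
  intro i hi j hj h
  simp only [Finset.coe_Ico, Set.mem_Ico] at hi hj
  have := congrFun h ⟨faceNode v i, isNode_faceNode (by omega) (by omega)⟩
  rw [fanExp_face (by omega) (by omega) (by omega) (by omega) rfl,
    fanExp_face (j := i) (by omega) (by omega) (by omega) (by omega) rfl, if_pos rfl] at this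
  by_contra hne
  rw [if_neg hne] at this
  exact one_ne_zero this

/-- Every arrow at a directed edge comes from a triangle with a corner at its source, and this
diagonal borders just two triangles. -/
theorem arrow_edgeNode_iff {l : ℕ} (hl : l ≠ 0) (hl' : l + 2 < n + 3) (p : Node (n + 3)) :
    (Arrow (fanGraph v) p (edgeNode v 0 (l + 1)) ↔
      p = edgeNode v 0 l ∨ p = faceNode v (l + 1)) ∧
    (Arrow (fanGraph v) (edgeNode v 0 (l + 1)) p ↔
      p = edgeNode v 0 (l + 2) ∨ p = faceNode v l) := by
  have t1 : IsTriangle (fanGraph v) (vtx v 0) (vtx v l) (vtx v (l + 1)) :=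
    (isTriangle_fanGraph_vtx (by omega) (by omega) (by omega)).2 (by omega)
  have t2 : IsTriangle (fanGraph v) (vtx v 0) (vtx v (l + 1)) (vtx v (l + 2)) :=
    (isTriangle_fanGraph_vtx (by omega) (by omega) (by omega)).2 (by omega)
  have prev : ∀ {b}, IsTriangle (fanGraph v) (vtx v 0) b (vtx v (l + 1)) → b = vtx v l := by
    intro b hb
    obtain ⟨j, hj, rfl⟩ := exists_vtx v b
    rw [isTriangle_fanGraph_vtx (by omega) hj (by omega)] at hb
    rw [vtx_inj hj (by omega)]
    omega
  have next : ∀ {b}, IsTriangle (fanGraph v) (vtx v 0) (vtx v (l + 1)) b → b = vtx v (l + 2) := by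
    intro b hb
    obtain ⟨j, hj, rfl⟩ := exists_vtx v b
    rw [isTriangle_fanGraph_vtx (by omega) (by omega) hj] at hb
    rw [vtx_inj hj (by omega)]
    omega
  refine ⟨⟨fun h => ?_, ?_⟩, ⟨fun h => ?_, ?_⟩⟩
  · cases h with
    | across h => rw [prev h]; exact Or.inl rfl
    | outward h => rw [next h]; exact Or.inr rfl
  · rintro (rfl | rfl)
    · exact .across t1
    · exact .outward t2
  · cases h with
    | across h => rw [next h]; exact Or.inl rfl
    | inward h => rw [prev h]; exact Or.inr rfl
  · rintro (rfl | rfl)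
    · exact .across t2
    · exact .inward t1

/-- The quotient of consecutive terms is `y_{l+1} q_l / (y_l q_{l+2})`, whose numerator and
denominator list the arrows into and out of the node. -/
theorem yhat_eq {l : ℕ} (hl : l ≠ 0) (hl' : l + 2 < n + 3) {k : QNode (fanGraph v)}
    (hk : k.1 = edgeNode v 0 (l + 1)) :
    fanExp v (l + 1) = fanExp v l + yhat (fanGraph v) k := by
  funext p
  obtain ⟨h1, h2⟩ := arrow_edgeNode_iff hl hl' p.1 (v := v)
  have hor : ∀ i j, ((if p.1 = edgeNode v 0 i ∨ p.1 = faceNode v j then 1 else 0) : ℤ) =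
      (if p.1 = edgeNode v 0 i then 1 else 0) + (if p.1 = faceNode v j then 1 else 0) := by
    intro i j
    by_cases h : p.1 = edgeNode v 0 i
    · simp [h]
    · simp [h]
  simp only [yhat, initialQuiver, hk, h1, h2, hor, Pi.add_apply, Pi.sub_apply, fanExp, nodeExp]
  ring

/-- The only directions along which terms of the expansion are related are those of directed
edges starting at the fan vertex. -/
theorem exists_eq_edge_of_yhat {i j : ℕ} {k : QNode (fanGraph v)} (hk : ¬ k.1.IsFrozen)
    (h : fanExp v j = fanExp v i + yhat (fanGraph v) k) :
    ∃ l, l ≠ 0 ∧ l + 2 < n + 3 ∧ k.1 = edgeNode v 0 (l + 1) := by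
  -- Edges not starting at `v` have exponent zero in all terms, so `k` cannot be joined to such a
  -- node. Every mutable node other than `v → w` is joined to one.
  have key : ∀ {a b : ℕ} (p : QNode (fanGraph v)), a ≠ 0 → a < n + 3 → p.1 = edgeNode v a b →
      ¬ (Arrow (fanGraph v) p.1 k.1 ∨ Arrow (fanGraph v) k.1 p.1) := by
    intro a b p ha ha' hp harr
    have h1 := congrFun h p
    rw [Pi.add_apply, fanExp_edge ha ha' hp, fanExp_edge ha ha' hp, zero_add] at h1
    exact yhat_ne_zero harr h1.symm
  rcases isNode_fanGraph k.2 with ⟨a, h1, h2, hka⟩ | ⟨a, h1, h2, hka⟩ | ⟨a, h1, h2, hka⟩ |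
      ⟨a, h1, h2, hka⟩ | ⟨a, h1, h2, hka⟩ <;> rw [hka] at hk <;>
    simp only [Node.IsFrozen] at hk
  · rw [isBoundary_vtx (by omega) (by omega)] at hk
    exact ⟨a - 1, by omega, by omega, by rw [hka, Nat.sub_add_cancel (by omega)]⟩
  · rw [isBoundary_vtx (by omega) (by omega)] at hk
    have ht : IsTriangle (fanGraph v) (vtx v a) (vtx v (a + 1)) (vtx v 0) :=
      (isTriangle_fanGraph_vtx (by omega) (by omega) (by omega)).2 (by omega)
    exact absurd (Or.inl (by rw [hka]; exact .across ht))
      (key ⟨edgeNode v a (a + 1), .edge ht.2.1⟩ h1 h2 rfl)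
  · exact absurd ((isBoundary_vtx (by omega) (by omega)).2 (by omega)) hk
  · exact absurd ((isBoundary_vtx (by omega) (by omega)).2 (by omega)) hk
  · have ht : IsTriangle (fanGraph v) (vtx v a) (vtx v (a + 1)) (vtx v 0) :=
      (isTriangle_fanGraph_vtx (by omega) (by omega) (by omega)).2 (by omega)
    exact absurd (Or.inl (by rw [hka, faceNode, ← face_rotate]; exact .inward ht))
      (key ⟨edgeNode v a 0, .edge ht.2.2.2.symm⟩ h1 (by omega) rfl)

theorem fanExp_step_iff {i j : ℕ} (hi0 : i ≠ 0) (hi : i < n + 2) (hj0 : j ≠ 0) (hj : j < n + 2) :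
    (∃ k : QNode (fanGraph v), ¬ k.1.IsFrozen ∧ fanExp v j = fanExp v i + yhat (fanGraph v) k) ↔
      i + 1 = j := by
  constructor
  · rintro ⟨k, hk, h⟩
    obtain ⟨l, h0, hl, hkl⟩ := exists_eq_edge_of_yhat hk h
    -- Both `fanExp v j - fanExp v i` and `fanExp v (l + 1) - fanExp v l` equal `ŷ_k`; the face
    -- exponents at `l` and `l + 1` then force `i = l` and `j = l + 1`.
    have hy : ∀ b, b ≠ 0 → b + 1 < n + 3 →
        ((if b = j then 1 else 0) - (if b = i then 1 else 0) : ℤ) =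
          (if b = l + 1 then 1 else 0) - (if b = l then 1 else 0) := by
      intro b hb hb'
      obtain ⟨q, hq⟩ : ∃ q : QNode (fanGraph v), q.1 = faceNode v b :=
        ⟨⟨_, isNode_faceNode hb hb'⟩, rfl⟩
      rw [← fanExp_face hi0 (by omega) hb hb' hq, ← fanExp_face hj0 (by omega) hb hb' hq,
        ← fanExp_face h0 (by omega) hb hb' hq,
        ← fanExp_face (Nat.succ_ne_zero l) (by omega) hb hb' hq, h, yhat_eq h0 hl hkl]
      simp
    have e1 := hy l h0 (by omega)
    have e2 := hy (l + 1) (by omega) (by omega)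
    split_ifs at e1 e2 <;> omega
  · rintro rfl
    have hadj : (fanGraph v).Adj (vtx v 0) (vtx v (i + 1)) :=
      (fanGraph_adj_vtx (by omega) (by omega)).2 (by omega)
    refine ⟨⟨edgeNode v 0 (i + 1), .edge hadj⟩, ?_, yhat_eq hi0 (by omega) rfl⟩
    simp only [Node.IsFrozen]
    rw [isBoundary_vtx (by omega) (by omega)]
    omega

end Poset

end

end SL3Fan

/-! ### The main theorem -/

theorem mainTheorem10 (n : ℕ) (Δ : SimpleGraph (Fin (n + 3))) (v : Fin (n + 3))
    (hΔ : SL3Fan.IsTriangulation Δ) (hv : SL3Fan.IsFanAt Δ v) :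
    (∃! x : SL3Fan.Ambient Δ, SL3Fan.IsFaceVariable Δ (SL3Fan.fanFace v) x) ∧
    ∀ x : SL3Fan.Ambient Δ, SL3Fan.IsFaceVariable Δ (SL3Fan.fanFace v) x →
      (∃ φ : ((· ≤ ·) : Fin (n + 1) → Fin (n + 1) → Prop) ≃r SL3Fan.ExpansionLE Δ x,
        ∀ i j : Fin (n + 1), i ⋖ j ↔ SL3Fan.YhatStep Δ x (φ i) (φ j)) ∧
      ∀ (m m' : SL3Fan.expansionMonomials Δ x) (k : SL3Fan.QNode Δ), ¬ k.1.IsFrozen →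
        m'.1 = m.1 + SL3Fan.yhat Δ k → ∃ w, k.1 = SL3Fan.Node.edge v w := by
  obtain rfl := SL3Fan.eq_fanGraph hΔ hv
  refine ⟨?_, fun x hx => ?_⟩
  · obtain ⟨x, hx⟩ := SL3Fan.exists_isFaceVariable v
    exact ⟨x, hx, fun y hy => hy.eq.trans hx.eq.symm⟩
  have hmem : ∀ m, m ∈ SL3Fan.expansionMonomials (SL3Fan.fanGraph v) x ↔
      ∃ l, (1 ≤ l ∧ l < n + 2) ∧ SL3Fan.fanExp v l = m := by
    intro m
    rw [hx.eq_sum, SL3Fan.expansionMonomials_sum SL3Fan.fanExp_injOn]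
    simp only [Finset.coe_Ico, Set.mem_image, Set.mem_Ico]
  refine ⟨?_, fun m m' k hk h => ?_⟩
  -- The terms are indexed from 1 to `n + 1`, hence the shift by one.
  · obtain ⟨φ, hφ⟩ : ∃ φ : Fin (n + 1) ≃ SL3Fan.expansionMonomials (SL3Fan.fanGraph v) x,
        ∀ i, (φ i).1 = SL3Fan.fanExp v (i + 1) := by
      refine ⟨Equiv.ofBijective (fun i => ⟨SL3Fan.fanExp v (i + 1), (hmem _).2
        ⟨i + 1, ⟨by omega, by omega⟩, rfl⟩⟩) ⟨fun i j hij => ?_, ?_⟩, fun i => rfl⟩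
      · have := SL3Fan.fanExp_injOn (v := v) (x₁ := i + 1) (x₂ := j + 1)
          (by simp; omega) (by simp; omega) (Subtype.ext_iff.1 hij)
        exact Fin.ext (Nat.succ_injective this)
      · rintro ⟨m, hm⟩
        obtain ⟨l, hl, rfl⟩ := (hmem m).1 hm
        exact ⟨⟨l - 1, by omega⟩, Subtype.ext (by simp only; rw [Nat.sub_add_cancel hl.1])⟩
    have hstep : ∀ i j : Fin (n + 1),
        i ⋖ j ↔ SL3Fan.YhatStep (SL3Fan.fanGraph v) x (φ i) (φ j) := by
      intro i j
      rw [SL3Fan.YhatStep, hφ, hφ,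
        SL3Fan.fanExp_step_iff (by omega) (by omega) (by omega) (by omega),
        Fin.covBy_iff, Nat.covBy_iff_add_one_eq]
      omega
    refine ⟨⟨φ, fun {i j} => ?_⟩, hstep⟩
    -- The order of a finite chain is generated by its covering relation, which `hstep` matches with
    -- the `ŷ` steps; so both orders are closures of corresponding relations.
    rw [le_iff_reflTransGen_covBy, SL3Fan.ExpansionLE]
    constructor
    · intro h
      have := Relation.ReflTransGen.lift (p := fun i j : Fin (n + 1) => i ⋖ j) φ.symm
        (fun a b hab => (hstep _ _).2 (by simpa using hab)) _ _ h
      simpa [Function.onFun] using this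
    · exact Relation.ReflTransGen.lift φ (fun a b hab => (hstep a b).1 hab) _ _
  · obtain ⟨i, -, hi⟩ := (hmem _).1 m.2
    obtain ⟨j, -, hj⟩ := (hmem _).1 m'.2
    rw [← hi, ← hj] at h
    obtain ⟨l, -, -, hl⟩ := SL3Fan.exists_eq_edge_of_yhat hk h
    exact ⟨SL3Fan.vtx v (l + 1), by rw [hl, SL3Fan.edgeNode, SL3Fan.vtx_zero]⟩
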